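/- Let $d\ge 2$, let $\mathbb S^d=\{x\in\mathbb R^{d+1}:|x|=1\}$ and let $\mathbb S^d_+=\mathbb S^d\cap\{x_{d+1}>0\}$ be the open hemisphere, with the round metric, surface measure $|\mathbb S^d_+|$ and boundary measure $|\partial\mathbb S^d_+|=|\mathbb S^{d-1}|$. A Dirichlet eigenvalue is a real number $\lambda$ for which there is $u\in H^1_0(\mathbb S^d_+)\setminus\{0\}$ with $\int_{\mathbb S^d_+}\nabla u\cdot\nabla\phi=\lambda\int_{\mathbb S^d_+}u\phi$ for all $\phi\in H^1_0(\mathbb S^d_+)$; for a Neumann eigenvalue $H^1_0(\mathbb S^d_+)$ is replaced by $H^1(\mathbb S^d_+)$ throughout. Let $$R_1^D(z)=\sum_j (z-\lambda_j)_+,\qquad R_1^N(z)=\sum_j (z-\mu_j)_+$$ where $\lambda_j$ (respectively $\mu_j$) are the Dirichlet (respectively Neumann) eigenvalues repeated according to multiplicity, and let $$L^{class}_{\gamma,d}=(4\pi)^{-d/2}\frac{\Gamma(\gamma+1)}{\Gamma(\gamma+1+d/2)},\qquad \psi(\eta)=\eta-\lfloor\eta\rfloor-\tfrac12 .$$ For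 $z\ge 0$ let $w=w(z)\ge 0$ be defined by $w(w+d-1)=z$. Then $R_1^D(z)$ and $R_1^N(z)$ are finite for all $z$, and as $z\to\infty$ $$\frac{R_1^D(z)}{L^{class}_{1,d}|\mathbb S^d_+|z^{d/2+1}}=1-\frac14\frac{L^{class}_{1,d-1}}{L^{class}_{1,d}}\frac{|\partial\mathbb S^d_+|}{|\mathbb S^d_+|}z^{-1/2}+\frac{d(d+2)}{2}\Big(\frac14-\psi^2(w)+\frac{d-2}{6}\Big)z^{-1}+O(z^{-3/2}),$$ $$\frac{R_1^N(z)}{L^{class}_{1,d}|\mathbb S^d_+|z^{d/2+1}}=1+\frac14\frac{L^{class}_{1,d-1}}{L^{class}_{1,d}}\frac{|\partial\mathbb S^d_+|}{|\mathbb S^d_+|}z^{-1/2}+\frac{d(d+2)}{2}\Big(\frac14-\psi^2(w)+\frac{d-2}{6}\Big)z^{-1}+O(z^{-3/2}),$$ or, equivalently, $$\frac{R_1^D(z)}{L^{class}_{1,d}|\mathbb S^d_+|z^{d/2+1}}=1-\frac{d(d+2)}{2(d+1)}z^{-1/2}+\frac{d(d+2)}{2}\Big(\frac14-\psi^2(w)+\frac{d-2}{6}\Big)z^{-1}+O(z^{-3/2}),$$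 $$\frac{R_1^N(z)}{L^{class}_{1,d}|\mathbb S^d_+|z^{d/2+1}}=1+\frac{d(d+2)}{2(d+1)}z^{-1/2}+\frac{d(d+2)}{2}\Big(\frac14-\psi^2(w)+\frac{d-2}{6}\Big)z^{-1}+O(z^{-3/2}).$$ -/

import Mathlib

open MeasureTheory Filter Asymptotics
open scoped ContDiff

noncomputable section

namespace HemisphereRiesz

/-- The ambient Euclidean space `ℝ^{d+1}` of the unit sphere `S^d`. -/
abbrev Amb (d : ℕ) : Type := EuclideanSpace ℝ (Fin (d + 1))

/-- The unit sphere `S^d` in `ℝ^{d+1}`. -/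
abbrev Sph (d : ℕ) : Type := Metric.sphere (0 : Amb d) 1

/-- The open upper half-space `{x ∈ ℝ^{d+1} : x_{d+1} > 0}`. -/
def upperHalf (d : ℕ) : Set (Amb d) := {x | 0 < x (Fin.last d)}

/-- The open hemisphere `S^d_+ = S^d ∩ {x_{d+1} > 0}`. -/
def hemi (d : ℕ) : Set (Sph d) := {x | (x : Amb d) ∈ upperHalf d}

/-- The surface (Riemannian) measure of `S^d`. -/
def surf (d : ℕ) : Measure (Sph d) := (volume : Measure (Amb d)).toSphere

/-- The surface measure on the hemisphere `S^d_+`. -/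
def hemiMeas (d : ℕ) : Measure (Sph d) := (surf d).restrict (hemi d)

/-- `|S^d_+|`. -/
def hemiArea (d : ℕ) : ℝ := (surf d).real (hemi d)

/-- `|∂S^d_+|`: the equator is the unit sphere `S^{d-1}` of the hyperplane `ℝ^d × {0}`, and this is
its `(d-1)`-dimensional surface measure. -/
def equatorArea (d : ℕ) : ℝ :=
  ((volume : Measure (EuclideanSpace ℝ (Fin d))).toSphere).real Set.univ

instance (d : ℕ) : IsFiniteMeasure (surf d) := by unfold surf; infer_instance

instance (d : ℕ) : IsFiniteMeasure (hemiMeas d) := by unfold hemiMeas; infer_instance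

/-- Smooth functions on `ℝ^{d+1}` (scalar or vector valued) supported in the open upper half-space.
As the sphere is compact, their restrictions to `S^d` are exactly the smooth functions on `S^d` whose
support is a compact subset of `S^d_+`. -/
def IsTest {d : ℕ} {F : Type*} [NormedAddCommGroup F] [NormedSpace ℝ F] (f : Amb d → F) : Prop :=
  ContDiff ℝ ∞ f ∧ tsupport f ⊆ upperHalf d

/-- The gradient on `S^d` of the restriction of `f`, at a point `x` of the sphere: the orthogonal
projection of the Euclidean gradient of `f` onto the tangent space `x^⊥`. -/
def sphGrad {d : ℕ} (f : Amb d → ℝ) (x : Amb d) : Amb d :=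
  gradient f x - (inner ℝ x (gradient f x)) • x

/-- The divergence on `S^d` of (the restriction of) a field `X` tangent to the sphere, at a point `x`
of the sphere: the trace of the derivative of `X` over the tangent space `x^⊥`. -/
def sphDiv {d : ℕ} (X : Amb d → Amb d) (x : Amb d) : ℝ :=
  LinearMap.trace ℝ (Amb d) (fderiv ℝ X x : Amb d →ₗ[ℝ] Amb d) - inner ℝ (fderiv ℝ X x x) x

/-- `L²(S^d_+)`. -/
abbrev L2Fun (d : ℕ) : Type := Lp ℝ 2 (hemiMeas d)

/-- Square integrable `ℝ^{d+1}`-valued fields on `S^d_+`. -/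
abbrev L2Vec (d : ℕ) : Type := Lp (Amb d) 2 (hemiMeas d)

/-- `g` is the weak gradient of `u` on `S^d_+`: it is tangent to the sphere, and
`∫ u div X = - ∫ ⟨g, X⟩` for all smooth tangent vector fields `X` with compact support in `S^d_+`. -/
def IsWeakGrad {d : ℕ} (u : L2Fun d) (g : L2Vec d) : Prop :=
  (∀ᵐ x ∂(hemiMeas d), inner ℝ (g x) (x : Amb d) = 0) ∧
  ∀ X : Amb d → Amb d, IsTest X → (∀ x : Sph d, inner ℝ (X x) (x : Amb d) = 0) →
    ∫ x, u x * sphDiv X x ∂(hemiMeas d) = - ∫ x, inner ℝ (g x) (X x) ∂(hemiMeas d)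

theorem integrable_mul_sphDiv {d : ℕ} (u : L2Fun d) {X : Amb d → Amb d} (hX : IsTest X) :
    Integrable (fun x : Sph d => u x * sphDiv X x) (hemiMeas d) := by
  have hu : Integrable (fun x => u x) (hemiMeas d) := (Lp.memLp u).integrable (by norm_num)
  have hD : Continuous (fun x : Amb d => fderiv ℝ X x) := hX.1.continuous_fderiv (by simp)
  have hc : Continuous (fun x : Sph d => sphDiv X (x : Amb d)) := by
    have h1 : Continuous (fun x : Amb d => sphDiv X x) := by
      have ht : Continuous (fun A : Amb d →L[ℝ] Amb d =>
          LinearMap.trace ℝ (Amb d) (A : Amb d →ₗ[ℝ] Amb d)) :=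
        LinearMap.continuous_of_finiteDimensional
          ((LinearMap.trace ℝ (Amb d)).comp (ContinuousLinearMap.coeLM ℝ))
      exact (ht.comp hD).sub ((hD.clm_apply continuous_id).inner continuous_id)
    exact h1.comp continuous_subtype_val
  obtain ⟨C, hC⟩ := (isCompact_univ (X := Sph d)).exists_bound_of_continuousOn hc.continuousOn
  exact hu.mul_bdd (c := C) hc.aestronglyMeasurable
    (Eventually.of_forall fun x => hC x (Set.mem_univ x))

theorem integrable_inner_field {d : ℕ} (g : L2Vec d) {X : Amb d → Amb d} (hX : IsTest X) :
    Integrable (fun x : Sph d => inner ℝ (g x) (X x)) (hemiMeas d) := by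
  have hc : Continuous (fun x : Sph d => X (x : Amb d)) :=
    hX.1.continuous.comp continuous_subtype_val
  obtain ⟨C, hC⟩ := (isCompact_univ (X := Sph d)).exists_bound_of_continuousOn hc.continuousOn
  have hg : Integrable (fun x => ‖g x‖ * C) (hemiMeas d) :=
    (((Lp.memLp g).integrable (by norm_num)).norm).mul_const C
  refine hg.mono' ((Lp.aestronglyMeasurable g).inner hc.aestronglyMeasurable)
    (Eventually.of_forall fun x => ?_)
  exact (norm_inner_le_norm _ _).trans
    (mul_le_mul_of_nonneg_left (hC x (Set.mem_univ x)) (norm_nonneg _))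

/-- The Sobolev space `H¹(S^d_+)`: all pairs `(u, ∇u)` with `u` in `L²` and weak gradient in `L²`. -/
def H1 (d : ℕ) : Submodule ℝ (L2Fun d × L2Vec d) where
  carrier := {p | IsWeakGrad p.1 p.2}
  zero_mem' := by
    have hV : ∀ᵐ x ∂(hemiMeas d), (0 : L2Vec d) x = 0 := Lp.coeFn_zero (Amb d) 2 (hemiMeas d)
    have hF : ∀ᵐ x ∂(hemiMeas d), (0 : L2Fun d) x = 0 := Lp.coeFn_zero ℝ 2 (hemiMeas d)
    refine ⟨?_, fun X _ _ => ?_⟩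
    · filter_upwards [hV] with x hx
      exact (congrArg (fun v => inner ℝ v (x : Amb d)) hx).trans (inner_zero_left _)
    · have h1 : ∫ x, (0 : L2Fun d) x * sphDiv X x ∂(hemiMeas d) = 0 := by
        refine integral_eq_zero_of_ae ?_
        filter_upwards [hF] with x hx
        rw [hx, zero_mul, Pi.zero_apply]
      have h2 : ∫ x, inner ℝ ((0 : L2Vec d) x) (X x) ∂(hemiMeas d) = 0 := by
        refine integral_eq_zero_of_ae ?_
        filter_upwards [hV] with x hx
        rw [hx, inner_zero_left, Pi.zero_apply]
      exact h1.trans ((neg_eq_zero.mpr h2).symm)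
  add_mem' := by
    rintro ⟨u, g⟩ ⟨v, h⟩ ⟨hu1, hu2⟩ ⟨hv1, hv2⟩
    refine ⟨?_, fun X hX hT => ?_⟩
    · filter_upwards [Lp.coeFn_add g h, hu1, hv1] with x hx h1 h2
      simp only [Prod.mk_add_mk] at *
      rw [hx, Pi.add_apply, inner_add_left, h1, h2, add_zero]
    · have e1 : ∫ x, (u + v) x * sphDiv X x ∂(hemiMeas d)
          = ∫ x, (u x * sphDiv X x + v x * sphDiv X x) ∂(hemiMeas d) := by
        refine integral_congr_ae ?_
        filter_upwards [Lp.coeFn_add u v] with x hx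
        rw [hx, Pi.add_apply, add_mul]
      have e2 : ∫ x, inner ℝ ((g + h) x) (X x) ∂(hemiMeas d)
          = ∫ x, (inner ℝ (g x) (X x) + inner ℝ (h x) (X x)) ∂(hemiMeas d) := by
        refine integral_congr_ae ?_
        filter_upwards [Lp.coeFn_add g h] with x hx
        rw [hx, Pi.add_apply, inner_add_left]
      have a := hu2 X hX hT
      have b := hv2 X hX hT
      simp only [Prod.mk_add_mk] at *
      rw [e1, e2, integral_add (integrable_mul_sphDiv u hX) (integrable_mul_sphDiv v hX),
        integral_add (integrable_inner_field g hX) (integrable_inner_field h hX), a, b]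
      ring
  smul_mem' := by
    rintro c ⟨u, g⟩ ⟨hu1, hu2⟩
    refine ⟨?_, fun X hX hT => ?_⟩
    · filter_upwards [Lp.coeFn_smul c g, hu1] with x hx h1
      simp only [Prod.smul_mk] at *
      rw [hx, Pi.smul_apply, real_inner_smul_left, h1, mul_zero]
    · have e1 : ∫ x, (c • u) x * sphDiv X x ∂(hemiMeas d)
          = ∫ x, c * (u x * sphDiv X x) ∂(hemiMeas d) := by
        refine integral_congr_ae ?_
        filter_upwards [Lp.coeFn_smul c u] with x hx
        rw [hx, Pi.smul_apply, smul_eq_mul, mul_assoc]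
      have e2 : ∫ x, inner ℝ ((c • g) x) (X x) ∂(hemiMeas d)
          = ∫ x, c * inner ℝ (g x) (X x) ∂(hemiMeas d) := by
        refine integral_congr_ae ?_
        filter_upwards [Lp.coeFn_smul c g] with x hx
        rw [hx, Pi.smul_apply, real_inner_smul_left]
      have a := hu2 X hX hT
      simp only [Prod.smul_mk] at *
      rw [e1, e2, integral_const_mul, integral_const_mul, a]
      ring

/-- The pairs `(φ, ∇φ)` with `φ` smooth and compactly supported in `S^d_+`. -/
def testPairs (d : ℕ) : Set (L2Fun d × L2Vec d) :=
  {p | ∃ φ : Amb d → ℝ, IsTest φ ∧ (∀ᵐ x ∂(hemiMeas d), p.1 x = φ x) ∧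
    ∀ᵐ x ∂(hemiMeas d), p.2 x = sphGrad φ x}

/-- The Sobolev space `H¹₀(S^d_+)` (as pairs `(u, ∇u)`): the closure of the smooth functions with
compact support in `S^d_+` with respect to the `H¹` norm. The span changes nothing, since
`testPairs` is a linear subspace. -/
def H10 (d : ℕ) : Submodule ℝ (L2Fun d × L2Vec d) :=
  (Submodule.span ℝ (testPairs d)).topologicalClosure

/-- For an energy space `V` (a space of pairs `(u, ∇u)`): the space of all `u` in `V` with
`∫ ∇u·∇φ = t ∫ u φ` for all `φ` in `V`. -/
def eigenspace {d : ℕ} (V : Submodule ℝ (L2Fun d × L2Vec d)) (t : ℝ) :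
    Submodule ℝ (L2Fun d) where
  carrier := {u | ∃ g, (u, g) ∈ V ∧ ∀ p ∈ V, inner ℝ g p.2 = t * inner ℝ u p.1}
  zero_mem' := ⟨0, V.zero_mem, by simp⟩
  add_mem' := by
    rintro u v ⟨g, hg, hu⟩ ⟨h, hh, hv⟩
    refine ⟨g + h, V.add_mem hg hh, fun p hp => ?_⟩
    rw [inner_add_left, inner_add_left, hu p hp, hv p hp, mul_add]
  smul_mem' := by
    rintro c u ⟨g, hg, hu⟩
    refine ⟨c • g, V.smul_mem c hg, fun p hp => ?_⟩
    rw [real_inner_smul_left, real_inner_smul_left, hu p hp]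
    ring

/-- The multiplicity of `t` as an eigenvalue (zero if `t` is not an eigenvalue, possibly infinite). -/
def multiplicity {d : ℕ} (V : Submodule ℝ (L2Fun d × L2Vec d)) (t : ℝ) : ℕ∞ :=
  Cardinal.toENat (Module.rank ℝ (eigenspace V t))

/-- The first Riesz mean `∑_j (z - λ_j)_+`, every eigenvalue being counted with its multiplicity. -/
def rieszMean {d : ℕ} (V : Submodule ℝ (L2Fun d × L2Vec d)) (z : ℝ) : ENNReal :=
  ∑' t : ℝ, (multiplicity V t : ENNReal) * ENNReal.ofReal (z - t)

/-- `R_1^D(z)` for the Dirichlet Laplacian on `S^d_+`. -/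
def rieszD (d : ℕ) (z : ℝ) : ENNReal := rieszMean (H10 d) z

/-- `R_1^N(z)` for the Neumann Laplacian on `S^d_+`. -/
def rieszN (d : ℕ) (z : ℝ) : ENNReal := rieszMean (H1 d) z

/-- The semiclassical constant `L^{class}_{γ,d}`. -/
def Lclass (γ d : ℝ) : ℝ :=
  (4 * Real.pi) ^ (-d / 2) * Real.Gamma (γ + 1) / Real.Gamma (γ + 1 + d / 2)

/-- The fluctuation function `ψ`. -/
def psi (η : ℝ) : ℝ := η - (⌊η⌋ : ℝ) - 1 / 2

end HemisphereRiesz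

end

noncomputable section

namespace HemisphereRiesz

/-! ### Asymptotics of the explicit sums -/

/-! On `S^d` a homogeneous harmonic polynomial of degree `k` satisfies `-Δp = k(k+d-1)p`. If `p` is
odd in the last coordinate it vanishes on the equator, and if it is even its normal derivative
vanishes there; so its restriction to the hemisphere is a Dirichlet, respectively Neumann,
eigenfunction (`oddHarmonic_mem_eigenspace`, `evenHarmonic_mem_eigenspace`). Each parity class alone
is total in `L²(S^d_+)`, by Stone-Weierstrass on the closed hemisphere. Since weak eigenvectors for
distinct eigenvalues are orthogonal, these spaces are therefore all the eigenspaces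
(`eigenspace_eq_of_total`, `multiplicity_of_total`).

The multiplicities are dimensions of spaces of polynomials. Surjectivity of the Laplacian on each
parity class gives `(k+d-1).choose (d-1)` for even polynomials of degree `k`, and the same number
for odd ones of degree `k+1`. Both Riesz means are thus finite sums cut off at `m = ⌊w⌋`, and they
have closed forms (`sum_even_closed`, `sum_odd_closed`).

With `r = √z` and `s = r - m`, a closed form divided by its leading term is a polynomial in `1/r`
with coefficients polynomial in `s`. The coefficient of `1/r` does not depend on `s`; that of `1/r²`
is quadratic in `s - d/2`. Completing the square in `w(w+d-1) = r²` gives `s = ψ(w) + d/2 + O(1/r)`,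
whence the term in `ψ²(w)` (`bound_of_expansion`). The Gamma duplication formula identifies the
leading constant with `L^{class}_{1,d}|S^d_+|` (`Lclass_mul_hemiArea`). -/

theorem choose_mul_factorial_eq_prod (a n : ℕ) :
    ((a + n).choose n : ℝ) * n.factorial = ∏ j ∈ Finset.range n, ((a : ℝ) + 1 + j) := by
  have h := Nat.ascFactorial_eq_factorial_mul_choose a n
  have h2 := Nat.ascFactorial_eq_prod_range (a + 1) n
  rw [h] at h2
  have h3 := congrArg (Nat.cast (R := ℝ)) h2
  push_cast at h3
  linarith

/-- The Neumann sum, with `n = d - 1`. The product over `(n+1)!` is the counting function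
`(m+n+1).choose (n+1)`, so the last bracket is `z` minus the mean of the eigenvalues counted. -/
theorem sum_even_closed (n : ℕ) (z : ℝ) (m : ℕ) :
    ∑ k ∈ Finset.range (m + 1), ((k + n).choose n : ℝ) * (z - k * (k + n)) =
      (∏ j ∈ Finset.range (n + 1), ((m : ℝ) + 1 + j)) / (n + 1).factorial *
        (z - (n + 1) * m * (m + n + 2) / (n + 3) + (n + 1) * m / (n + 2)) := by
  induction m with
  | zero =>
    have h := choose_mul_factorial_eq_prod 0 (n + 1)
    have h0 : ((n + 1).factorial : ℝ) ≠ 0 := by positivity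
    rw [Nat.zero_add, Nat.choose_self] at h
    rw [← h]
    simp [h0]
  | succ m ih =>
    have h := choose_mul_factorial_eq_prod (m + 1) n
    have h0 : (n.factorial : ℝ) ≠ 0 := by positivity
    rw [Finset.sum_range_succ, ih, Finset.prod_range_succ', Finset.prod_range_succ,
      Nat.factorial_succ]
    have e : ∏ k ∈ Finset.range n, ((m : ℝ) + 1 + ((k + 1 : ℕ) : ℝ)) =
        ∏ j ∈ Finset.range n, (((m + 1 : ℕ) : ℝ) + 1 + j) := by
      refine Finset.prod_congr rfl fun j _ => ?_
      push_cast; ring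
    rw [e, ← h]
    push_cast
    field_simp
    ring

/-- The Dirichlet sum. The degree is `k + 1`, because no odd polynomial has degree zero; the
counting function is now `(m+n).choose (n+1)`. -/
theorem sum_odd_closed (n : ℕ) (z : ℝ) (m : ℕ) :
    ∑ k ∈ Finset.range m, ((k + n).choose n : ℝ) * (z - (k + 1) * (k + 1 + n)) =
      (∏ j ∈ Finset.range (n + 1), ((m : ℝ) + j)) / (n + 1).factorial *
        (z - (n + 1) * (m + n + 1) * (m + n + 2) / (n + 3)
          + (n + 1) ^ 2 * (m + n + 1) / (n + 2)) := by
  induction m with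
  | zero => simp [Finset.prod_range_succ']
  | succ m ih =>
    have h := choose_mul_factorial_eq_prod m n
    have h0 : (n.factorial : ℝ) ≠ 0 := by positivity
    rw [Finset.sum_range_succ, ih, Finset.prod_range_succ', Finset.prod_range_succ,
      Nat.factorial_succ]
    have e : ∏ k ∈ Finset.range n, ((m : ℝ) + ((k + 1 : ℕ) : ℝ)) =
        ∏ j ∈ Finset.range n, ((m : ℝ) + 1 + j) := by
      refine Finset.prod_congr rfl fun j _ => ?_
      push_cast; ring
    have e2 : ∏ k ∈ Finset.range n, (((m + 1 : ℕ) : ℝ) + k) =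
        ∏ j ∈ Finset.range n, ((m : ℝ) + 1 + j) := by
      refine Finset.prod_congr rfl fun j _ => ?_
      push_cast; ring
    rw [e, e2, ← h]
    push_cast
    field_simp
    ring

/-- The first elementary symmetric function of `1 - S, …, d - S`. -/
def esymmOne (d : ℕ) (S : ℝ) : ℝ := d * (d + 1) / 2 - d * S

/-- The second elementary symmetric function of `1 - S, …, d - S`. -/
def esymmTwo (d : ℕ) (S : ℝ) : ℝ :=
  (esymmOne d S ^ 2 - (d * (d + 1) * (2 * d + 1) / 6 - S * (d * (d + 1)) + d * S ^ 2)) / 2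

/-- Joint continuity of `ρ` is the point: on a compact set of `(S, ε)` it bounds the remainder
uniformly. -/
theorem exists_prod_expansion (d : ℕ) : ∃ ρ : ℝ × ℝ → ℝ, Continuous ρ ∧ ∀ S ε : ℝ,
    ∏ j ∈ Finset.range d, (1 + ((j : ℝ) + 1 - S) * ε) =
      1 + esymmOne d S * ε + esymmTwo d S * ε ^ 2 + ε ^ 3 * ρ (S, ε) := by
  induction d with
  | zero => exact ⟨fun _ => 0, continuous_const, fun S ε => by simp [esymmOne, esymmTwo]⟩
  | succ d ih =>
    obtain ⟨ρ, hρ, h⟩ := ih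
    refine ⟨fun p => ρ p * (1 + (d + 1 - p.1) * p.2) + esymmTwo d p.1 * (d + 1 - p.1), ?_, ?_⟩
    · unfold esymmTwo esymmOne
      fun_prop
    · intro S ε
      rw [Finset.prod_range_succ, h]
      simp only [esymmOne, esymmTwo]
      push_cast
      ring

/-- Common to both boundary conditions: `e = 0` is Neumann and `e = 1` Dirichlet. The product comes
from the counting function, the quadratic in `ε = 1/r` from the bracket of the closed form.
Hypothesis `h₁` says that the boundary term does not oscillate, as `c₁` is free of `s`. -/
theorem exists_expansion (d : ℕ) (e c₁ : ℝ) (b₂ : ℝ) (b₁ b₀ g : ℝ → ℝ)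
    (hb₁ : Continuous b₁) (hb₀ : Continuous b₀)
    (h₂ : (d + 2) / 2 * b₂ = 1)
    (h₁ : ∀ s, (d + 2) / 2 * (b₁ s + esymmOne d (s + e) * b₂) = c₁)
    (h₀ : ∀ s, (d + 2) / 2 * (b₀ s + esymmOne d (s + e) * b₁ s + esymmTwo d (s + e) * b₂) = g s) :
    ∃ ρ : ℝ × ℝ → ℝ, Continuous ρ ∧ ∀ s ε : ℝ,
      (d + 2) / 2 * ((∏ j ∈ Finset.range d, (1 + ((j : ℝ) + 1 - (s + e)) * ε)) *
        (b₂ + b₁ s * ε + b₀ s * ε ^ 2)) = 1 + c₁ * ε + g s * ε ^ 2 + ε ^ 3 * ρ (s, ε) := by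
  obtain ⟨ρ, hρ, h⟩ := exists_prod_expansion d
  refine ⟨fun p => (d + 2) / 2 * (ρ (p.1 + e, p.2) * (b₂ + b₁ p.1 * p.2 + b₀ p.1 * p.2 ^ 2) +
    (esymmTwo d (p.1 + e) * b₁ p.1 + esymmOne d (p.1 + e) * b₀ p.1) +
    esymmTwo d (p.1 + e) * b₀ p.1 * p.2), ?_, ?_⟩
  · unfold esymmTwo esymmOne
    fun_prop
  · intro s ε
    rw [h, ← h₁ s, ← h₀ s]
    linear_combination h₂

/-- The coefficient of `z⁻¹`, as a function of the distance of `√z` to the cutoff index. -/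
def quadCoeff (d : ℕ) (s : ℝ) : ℝ :=
  (d : ℝ) * (d + 2) / 2 * (1 / 4 - (s - d / 2) ^ 2 + ((d : ℝ) - 2) / 6)

/-- Here `r - ⌊w⌋ = ψ(w) + d/2 - δ` with `0 ≤ δ ≤ d²/r`. Replacing `r - ⌊w⌋ - d/2` by `ψ(w)` in the
coefficient of `1/r²` therefore costs only `O(1/r³)`, and `ρ` is bounded because its arguments stay
in a fixed box. -/
theorem bound_of_expansion (d : ℕ) (c₁ : ℝ) (ρ : ℝ × ℝ → ℝ) (hρ : Continuous ρ) :
    ∃ K : ℝ, ∀ r w : ℝ, 1 ≤ r → 0 ≤ w → w * (w + d - 1) = r ^ 2 → 1 ≤ d →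
      |(1 + c₁ * r⁻¹ + quadCoeff d (r - ⌊w⌋₊) * r⁻¹ ^ 2 + r⁻¹ ^ 3 * ρ (r - ⌊w⌋₊, r⁻¹)) -
        (1 + c₁ * r⁻¹ + d * (d + 2) / 2 * (1 / 4 - psi w ^ 2 + ((d : ℝ) - 2) / 6) * r⁻¹ ^ 2)|
        ≤ K * r⁻¹ ^ 3 := by
  have hcomp : IsCompact ((Set.Icc (-(d : ℝ) ^ 2) (d + 1)) ×ˢ (Set.Icc (0 : ℝ) 1)) :=
    isCompact_Icc.prod isCompact_Icc
  obtain ⟨C, hC⟩ := hcomp.exists_bound_of_continuousOn hρ.continuousOn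
  -- `C` bounds `ρ` on the box; the rest is a generous bound for `r` times the change of the
  -- quadratic coefficient.
  refine ⟨C + d * (d + 2) / 2 * (d ^ 2 * (2 * (d ^ 2 + d + 3))), fun r w hr hw hz hd => ?_⟩
  have hd' : (1 : ℝ) ≤ d := by exact_mod_cast hd
  have hr0 : 0 < r := by linarith
  have hε0 : 0 < r⁻¹ := by positivity
  have hε1 : r⁻¹ ≤ 1 := inv_le_one_of_one_le₀ hr
  have hfl : (⌊w⌋ : ℝ) = (⌊w⌋₊ : ℝ) := (natCast_floor_eq_intCast_floor hw).symm
  set m : ℝ := (⌊w⌋₊ : ℝ) with hm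
  have hm1 : m ≤ w := Nat.floor_le hw
  have hm2 : w < m + 1 := Nat.lt_floor_add_one w
  -- `δ` is the distance of `√z` to `w + (d-1)/2`
  set δ := w + (d - 1) / 2 - r with hδ
  -- Completing the square: `(w + (d-1)/2)² - r² = ((d-1)/2)²`, factored as a difference of squares.
  have hsq : δ * (w + (d - 1) / 2 + r) = ((d - 1) / 2 : ℝ) ^ 2 := by rw [hδ]; nlinarith
  have hpos : r ≤ w + (d - 1) / 2 + r := by linarith
  have hδ0 : 0 ≤ δ := by
    by_contra hneg
    push Not at hneg
    nlinarith [sq_nonneg ((d - 1) / 2 : ℝ)]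
  have hδ1 : δ * r ≤ d ^ 2 := by nlinarith
  have hδ2 : δ ≤ d ^ 2 * r⁻¹ := by
    rw [← div_eq_mul_inv, le_div_iff₀ hr0]; exact hδ1
  have hδ3 : δ ≤ d ^ 2 := by nlinarith
  have hs1 : r - m = (w - m) + (d - 1) / 2 - δ := by rw [hδ]; ring
  have hmem : (r - m, r⁻¹) ∈ (Set.Icc (-(d : ℝ) ^ 2) (d + 1)) ×ˢ (Set.Icc (0 : ℝ) 1) := by
    refine ⟨⟨?_, ?_⟩, ⟨hε0.le, hε1⟩⟩
    · show -(d : ℝ) ^ 2 ≤ r - m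
      linarith
    · show r - m ≤ d + 1
      linarith
  have hb := hC _ hmem
  rw [Real.norm_eq_abs] at hb
  have hpsi : psi w = w - m - 1 / 2 := by rw [psi, hfl]
  have hq : quadCoeff d (r - m) - d * (d + 2) / 2 * (1 / 4 - psi w ^ 2 + ((d : ℝ) - 2) / 6) =
      d * (d + 2) / 2 * (δ * (2 * (w - m - 1 / 2) - δ)) := by
    rw [quadCoeff, hpsi, hs1]; ring
  have hq2 : |δ * (2 * (w - m - 1 / 2) - δ)| ≤ d ^ 2 * (2 * (d ^ 2 + d + 3)) * r⁻¹ := by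
    rw [abs_mul, abs_of_nonneg hδ0]
    have : |2 * (w - m - 1 / 2) - δ| ≤ 2 * (d ^ 2 + d + 3) := by
      rw [abs_le]; constructor <;> nlinarith
    calc δ * |2 * (w - m - 1 / 2) - δ| ≤ (d ^ 2 * r⁻¹) * (2 * (d ^ 2 + d + 3)) := by gcongr
      _ = _ := by ring
  have key : (1 + c₁ * r⁻¹ + quadCoeff d (r - m) * r⁻¹ ^ 2 + r⁻¹ ^ 3 * ρ (r - m, r⁻¹)) -
        (1 + c₁ * r⁻¹ + d * (d + 2) / 2 * (1 / 4 - psi w ^ 2 + ((d : ℝ) - 2) / 6) * r⁻¹ ^ 2) =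
      (d * (d + 2) / 2 * (δ * (2 * (w - m - 1 / 2) - δ))) * r⁻¹ ^ 2 +
        r⁻¹ ^ 3 * ρ (r - m, r⁻¹) := by
    rw [← hq]; ring
  rw [key]
  calc _ ≤ |(d * (d + 2) / 2 * (δ * (2 * (w - m - 1 / 2) - δ))) * r⁻¹ ^ 2| +
        |r⁻¹ ^ 3 * ρ (r - m, r⁻¹)| := abs_add_le _ _
    _ = d * (d + 2) / 2 * |δ * (2 * (w - m - 1 / 2) - δ)| * r⁻¹ ^ 2 +
        r⁻¹ ^ 3 * |ρ (r - m, r⁻¹)| := by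
      rw [abs_mul _ (r⁻¹ ^ 2), abs_mul ((d : ℝ) * (d + 2) / 2), abs_mul (r⁻¹ ^ 3),
        abs_of_nonneg (by positivity : (0 : ℝ) ≤ d * (d + 2) / 2),
        abs_of_nonneg (by positivity : (0 : ℝ) ≤ r⁻¹ ^ 2),
        abs_of_nonneg (by positivity : (0 : ℝ) ≤ r⁻¹ ^ 3)]
    _ ≤ d * (d + 2) / 2 * (d ^ 2 * (2 * (d ^ 2 + d + 3)) * r⁻¹) * r⁻¹ ^ 2 + r⁻¹ ^ 3 * C := by
      gcongr
    _ = _ := by ring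

theorem prod_scale (d : ℕ) (r s e : ℝ) (hr : r ≠ 0) :
    ∏ j ∈ Finset.range d, (r - s + 1 - e + j) =
      r ^ d * ∏ j ∈ Finset.range d, (1 + ((j : ℝ) + 1 - (s + e)) * r⁻¹) := by
  rw [← Finset.card_range d, ← Finset.prod_const, Finset.card_range, ← Finset.prod_mul_distrib]
  refine Finset.prod_congr rfl fun j _ => ?_
  field_simp
  ring

theorem even_sum_asymptotics (n : ℕ) : ∃ K : ℝ, ∀ r w : ℝ, 1 ≤ r → 0 ≤ w →
    w * (w + n) = r ^ 2 →
    |(∑ k ∈ Finset.range (⌊w⌋₊ + 1), ((k + n).choose n : ℝ) * (r ^ 2 - k * (k + n))) /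
        (2 / ((n + 3) * (n + 1).factorial) * r ^ (n + 3)) -
      (1 + ((n : ℝ) + 1) * (n + 3) / (2 * (n + 2)) * r⁻¹ +
        ((n : ℝ) + 1) * (n + 3) / 2 * (1 / 4 - psi w ^ 2 + ((n : ℝ) - 1) / 6) * r⁻¹ ^ 2)|
      ≤ K * r⁻¹ ^ 3 := by
  -- The functions `b₂`, `b₁`, `b₀` are the coefficients of `r²`, `r`, `1` after substituting `z =
  -- r²` and `m = r - s` in the bracket of `sum_even_closed`.
  obtain ⟨ρ, hρ, h⟩ := exists_expansion (n + 1) 0 (((n : ℝ) + 1) * (n + 3) / (2 * (n + 2)))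
    (2 / (n + 3))
    (fun s => 2 * (n + 1) * s / (n + 3) - (n + 1) * (n + 2) / (n + 3) + (n + 1) / (n + 2))
    (fun s => -(n + 1) * s ^ 2 / (n + 3) + (n + 1) * (n + 2) * s / (n + 3) - (n + 1) * s / (n + 2))
    (quadCoeff (n + 1)) (by fun_prop) (by fun_prop)
    (by push_cast; field_simp; ring)
    (by intro s; simp only [esymmOne]; push_cast; field_simp; ring)
    (by intro s; simp only [esymmOne, esymmTwo, quadCoeff]; push_cast; field_simp; ring)
  obtain ⟨K, hK⟩ := bound_of_expansion (n + 1) (((n : ℝ) + 1) * (n + 3) / (2 * (n + 2))) ρ hρ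
  refine ⟨K, fun r w hr hw hz => ?_⟩
  have hr0 : r ≠ 0 := by linarith
  have := hK r w hr hw (by push_cast; rw [← hz]; ring) (by omega)
  rw [← h] at this
  convert this using 2
  congr 1
  · rw [sum_even_closed]
    have e := prod_scale (n + 1) r (r - ⌊w⌋₊) 0 hr0
    rw [show r - (r - (⌊w⌋₊ : ℝ)) + 1 - 0 = ⌊w⌋₊ + 1 by ring] at e
    rw [e]
    have : ((n + 1).factorial : ℝ) ≠ 0 := by positivity
    push_cast
    generalize ∏ j ∈ Finset.range (n + 1), (1 + ((j : ℝ) + 1 - (r - (⌊w⌋₊ : ℝ) + 0)) * r⁻¹) = P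
    field_simp
    ring
  · push_cast; ring

theorem odd_sum_asymptotics (n : ℕ) : ∃ K : ℝ, ∀ r w : ℝ, 1 ≤ r → 0 ≤ w →
    w * (w + n) = r ^ 2 →
    |(∑ k ∈ Finset.range ⌊w⌋₊, ((k + n).choose n : ℝ) * (r ^ 2 - (k + 1) * (k + 1 + n))) /
        (2 / ((n + 3) * (n + 1).factorial) * r ^ (n + 3)) -
      (1 - ((n : ℝ) + 1) * (n + 3) / (2 * (n + 2)) * r⁻¹ +
        ((n : ℝ) + 1) * (n + 3) / 2 * (1 / 4 - psi w ^ 2 + ((n : ℝ) - 1) / 6) * r⁻¹ ^ 2)|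
      ≤ K * r⁻¹ ^ 3 := by
  obtain ⟨ρ, hρ, h⟩ := exists_expansion (n + 1) 1 (-(((n : ℝ) + 1) * (n + 3) / (2 * (n + 2))))
    -- As in the even case, these three are read off from the bracket of `sum_odd_closed` at `z =
    -- r²`, `m = r - s`.
    (2 / (n + 3))
    (fun s => 2 * (n + 1) * s / (n + 3) - (n + 1) * (2 * n + 3) / (n + 3) + (n + 1) ^ 2 / (n + 2))
    (fun s => -(n + 1) * (s - n - 1) * (s - n - 2) / (n + 3) - (n + 1) ^ 2 * (s - n - 1) / (n + 2))
    (quadCoeff (n + 1)) (by fun_prop) (by fun_prop)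
    (by push_cast; field_simp; ring)
    (by intro s; simp only [esymmOne]; push_cast; field_simp; ring)
    (by intro s; simp only [esymmOne, esymmTwo, quadCoeff]; push_cast; field_simp; ring)
  obtain ⟨K, hK⟩ := bound_of_expansion (n + 1) (-(((n : ℝ) + 1) * (n + 3) / (2 * (n + 2)))) ρ hρ
  refine ⟨K, fun r w hr hw hz => ?_⟩
  have hr0 : r ≠ 0 := by linarith
  have := hK r w hr hw (by push_cast; rw [← hz]; ring) (by omega)
  rw [← h] at this
  convert this using 2
  congr 1
  · rw [sum_odd_closed]
    have e := prod_scale (n + 1) r (r - ⌊w⌋₊) 1 hr0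
    rw [show r - (r - (⌊w⌋₊ : ℝ)) + 1 - 1 = ⌊w⌋₊ by ring] at e
    rw [e]
    have : ((n + 1).factorial : ℝ) ≠ 0 := by positivity
    push_cast
    generalize ∏ j ∈ Finset.range (n + 1), (1 + ((j : ℝ) + 1 - (r - (⌊w⌋₊ : ℝ) + 1)) * r⁻¹) = P
    field_simp
    ring
  · push_cast; ring

/-! ### Homogeneous harmonic polynomials of given parity in one variable -/

section Harmonic

open MvPolynomial

set_option linter.unusedSectionVars false

variable {σ : Type*} [Fintype σ] [DecidableEq σ]

/-- Exponents of degree `k` whose `L`-th entry has parity `e`. -/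
def parityExps (L : σ) (e k : ℕ) : Set (σ →₀ ℕ) := {s | s.degree = k ∧ s L % 2 = e}

/-- Homogeneous polynomials of degree `k` that have parity `e` in the variable `L`. -/
def parityPoly (L : σ) (e k : ℕ) : Submodule ℝ (MvPolynomial σ ℝ) :=
  restrictSupport ℝ (parityExps L e k)

/-- The Laplacian on polynomials. -/
def polyLap : MvPolynomial σ ℝ →ₗ[ℝ] MvPolynomial σ ℝ :=
  ∑ i, (pderiv i).toLinearMap ∘ₗ (pderiv i).toLinearMap

/-- The polynomial `|x|²`. -/
def polyNormSq : MvPolynomial σ ℝ := ∑ i, X i ^ 2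

/-- Harmonic homogeneous polynomials of degree `k` that have parity `e` in the variable `L`. -/
def parityHarmonic (L : σ) (e k : ℕ) : Submodule ℝ (MvPolynomial σ ℝ) :=
  parityPoly L e k ⊓ LinearMap.ker polyLap

theorem polyLap_apply (p : MvPolynomial σ ℝ) : polyLap p = ∑ i, pderiv i (pderiv i p) := by
  simp [polyLap]

theorem parityPoly_isHomogeneous {L : σ} {e k : ℕ} {p : MvPolynomial σ ℝ}
    (hp : p ∈ parityPoly L e k) : p.IsHomogeneous k := by
  intro s hs
  have h := ((mem_restrictSupport_iff ℝ).mp hp) (Finset.mem_coe.mpr (mem_support_iff.mpr hs))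
  rw [← h.1, Finsupp.degree_eq_weight_one]
  rfl

theorem parityPoly_induction {L : σ} {e k : ℕ} (V : Submodule ℝ (MvPolynomial σ ℝ))
    (f : MvPolynomial σ ℝ →ₗ[ℝ] MvPolynomial σ ℝ)
    (h : ∀ s ∈ parityExps L e k, f (monomial s 1) ∈ V) {p : MvPolynomial σ ℝ}
    (hp : p ∈ parityPoly L e k) : f p ∈ V := by
  have : parityPoly L e k ≤ V.comap f := by
    rw [parityPoly, restrictSupport_eq_span, Submodule.span_le]
    rintro _ ⟨s, hs, rfl⟩
    exact h s hs
  exact this hp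

theorem pderiv_pderiv_mem {L : σ} {e k : ℕ} {p : MvPolynomial σ ℝ} (i : σ)
    (hp : p ∈ parityPoly L e (k + 2)) : pderiv i (pderiv i p) ∈ parityPoly L e k := by
  refine parityPoly_induction (parityPoly L e k)
    ((pderiv i).toLinearMap ∘ₗ (pderiv i).toLinearMap) (fun s hs => ?_) hp
  simp only [LinearMap.comp_apply, Derivation.coeFn_coe, pderiv_monomial]
  rw [parityPoly, monomial_mem_restrictSupport]
  by_cases h : 2 ≤ s i
  · left
    have hle : Finsupp.single i 2 ≤ s := by simpa using h
    have h2 : s - Finsupp.single i 1 - Finsupp.single i 1 = s - Finsupp.single i 2 := by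
      rw [tsub_tsub, ← Finsupp.single_add]
    rw [h2]
    obtain ⟨t, rfl⟩ := exists_add_of_le hle
    obtain ⟨h3, h4⟩ := hs
    rw [add_tsub_cancel_left]
    refine ⟨?_, ?_⟩
    · rw [map_add, Finsupp.degree_single] at h3
      omega
    · rw [Finsupp.add_apply, Finsupp.single_apply] at h4
      split_ifs at h4 <;> omega
  -- If the exponent of `i` is below two, the second derivative has coefficient zero.
  · right
    have : s i = 0 ∨ s i = 1 := by omega
    rcases this with h | h <;> simp [h]

theorem polyLap_mem {L : σ} {e k : ℕ} {p : MvPolynomial σ ℝ}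
    (hp : p ∈ parityPoly L e (k + 2)) : polyLap p ∈ parityPoly L e k := by
  rw [polyLap_apply]
  exact Submodule.sum_mem _ fun i _ => pderiv_pderiv_mem i hp

theorem polyNormSq_mul_mem {L : σ} {e k : ℕ} {p : MvPolynomial σ ℝ}
    (hp : p ∈ parityPoly L e k) : polyNormSq * p ∈ parityPoly L e (k + 2) := by
  rw [polyNormSq, Finset.sum_mul]
  refine Submodule.sum_mem _ fun i _ => ?_
  refine parityPoly_induction (parityPoly L e (k + 2)) (LinearMap.mulLeft ℝ (X i ^ 2))
    (fun s hs => ?_) hp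
  rw [LinearMap.mulLeft_apply, X_pow_eq_monomial, monomial_mul, parityPoly,
    monomial_mem_restrictSupport]
  left
  obtain ⟨h3, h4⟩ := hs
  refine ⟨?_, ?_⟩
  · rw [map_add, Finsupp.degree_single]; omega
  · rw [Finsupp.add_apply, Finsupp.single_apply]
    split_ifs <;> omega

theorem polyLap_eq_zero_of_degree_lt {L : σ} {e k : ℕ} (hk : k < 2) {p : MvPolynomial σ ℝ}
    (hp : p ∈ parityPoly L e k) : polyLap p = 0 := by
  suffices h : polyLap p ∈ (⊥ : Submodule ℝ (MvPolynomial σ ℝ)) by simpa using h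
  refine parityPoly_induction ⊥ polyLap (fun s hs => ?_) hp
  rw [Submodule.mem_bot, polyLap_apply]
  refine Finset.sum_eq_zero fun i _ => ?_
  have hi : s i ≤ s.degree := Finsupp.le_degree i s
  have : s i = 0 ∨ s i = 1 := by
    have := hs.1
    omega
  rcases this with h | h <;> simp [pderiv_monomial, h]

theorem pderiv_polyNormSq (i : σ) : pderiv i (polyNormSq : MvPolynomial σ ℝ) = 2 * X i := by
  rw [polyNormSq, map_sum, Finset.sum_eq_single i]
  · rw [pderiv_pow, pderiv_X_self]; push_cast; ring
  · intro j _ hj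
    rw [pderiv_pow, pderiv_X_of_ne hj]; ring
  · simp

/-- The product rule gives the cross term `4 x·∇f`, which Euler's identity turns into `4 n f`; the
term with `card σ` is `Δ|x|²`. -/
theorem polyLap_normSq_mul {n : ℕ} {f : MvPolynomial σ ℝ} (hf : f.IsHomogeneous n) :
    polyLap (polyNormSq * f) =
      polyNormSq * polyLap f + (4 * n + 2 * Fintype.card σ : ℝ) • f := by
  have h1 : ∀ i : σ, pderiv i (pderiv i (polyNormSq * f)) =
      polyNormSq * pderiv i (pderiv i f) + 4 * (X i * pderiv i f) + 2 * f := by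
    intro i
    have : pderiv i (2 * X i : MvPolynomial σ ℝ) = 2 := by
      rw [pderiv_mul, pderiv_X_self]
      have : pderiv i (2 : MvPolynomial σ ℝ) = 0 := by
        rw [show (2 : MvPolynomial σ ℝ) = C 2 from (map_ofNat C 2).symm]; exact pderiv_C
      rw [this]; ring
    rw [pderiv_mul, pderiv_polyNormSq, map_add, pderiv_mul (f := 2 * X i), this,
      pderiv_mul (f := polyNormSq), pderiv_polyNormSq]
    ring
  rw [polyLap_apply, polyLap_apply]
  simp_rw [h1]
  rw [Finset.sum_add_distrib, Finset.sum_add_distrib, ← Finset.mul_sum, ← Finset.mul_sum,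
    hf.sum_X_mul_pderiv, Finset.sum_const, Finset.card_univ, add_assoc]
  congr 1
  rw [MvPolynomial.smul_eq_C_mul]
  simp only [nsmul_eq_mul, map_add, map_mul, map_natCast, map_ofNat]
  ring

theorem polyNormSq_isHomogeneous : (polyNormSq : MvPolynomial σ ℝ).IsHomogeneous 2 :=
  IsHomogeneous.sum _ _ _ fun i _ => isHomogeneous_X_pow i 2

/-- Only the positivity of `c` matters: it allows division, and hence the inversion of the Laplacian
on multiples of `|x|²`. -/
theorem exists_polyLap_normSq_pow_mul [Nonempty σ] {m : ℕ} {h : MvPolynomial σ ℝ}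
    (hh : h.IsHomogeneous m) (h0 : polyLap h = 0) (j : ℕ) :
    ∃ c : ℝ, 0 < c ∧ polyLap (polyNormSq ^ (j + 1) * h) = c • (polyNormSq ^ j * h) := by
  have hcard : (0 : ℝ) < Fintype.card σ := by exact_mod_cast Fintype.card_pos
  induction j with
  | zero =>
    refine ⟨4 * m + 2 * Fintype.card σ, by positivity, ?_⟩
    rw [zero_add, pow_one, polyLap_normSq_mul hh, h0]; simp
  | succ j ih =>
    obtain ⟨c, hc, hj⟩ := ih
    have hd : (polyNormSq ^ (j + 1) * h).IsHomogeneous (2 * (j + 1) + m) :=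
      (polyNormSq_isHomogeneous.pow (j + 1)).mul hh
    refine ⟨c + (4 * (2 * (j + 1) + m : ℕ) + 2 * Fintype.card σ), by positivity, ?_⟩
    rw [pow_succ' polyNormSq (j + 1), mul_assoc, polyLap_normSq_mul hd, hj,
      mul_smul_comm, ← mul_assoc, ← pow_succ', ← add_smul]

/-- Every polynomial of parity `e` is harmonic up to a multiple of `|x|²`, and
`q ↦ Δ(|x|^{2j+2} q)` hits every multiple of `|x|^{2j}`. -/
theorem exists_polyLap_eq_and_decomposition (L : σ) (e : ℕ) (k : ℕ) :
    (∀ p ∈ parityPoly L e k, ∀ j : ℕ, ∃ q ∈ parityPoly L e k,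
      polyLap (polyNormSq ^ (j + 1) * q) = polyNormSq ^ j * p) ∧
    (∀ p ∈ parityPoly L e k, p ∈ parityHarmonic L e k ∨ ∃ h ∈ parityHarmonic L e k, ∃ i, i + 2 = k ∧
      ∃ q ∈ parityPoly L e i, p = h + polyNormSq * q) := by
  have : Nonempty σ := ⟨L⟩
  induction k using Nat.strong_induction_on with
  | _ k ih =>
    have hdec : ∀ p ∈ parityPoly L e k, p ∈ parityHarmonic L e k ∨
        ∃ h ∈ parityHarmonic L e k, ∃ i, i + 2 = k ∧
        ∃ q ∈ parityPoly L e i, p = h + polyNormSq * q := by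
      intro p hp
      rcases lt_or_ge k 2 with hk | hk
      · exact Or.inl ⟨hp, polyLap_eq_zero_of_degree_lt hk hp⟩
      · right
        obtain ⟨i, rfl⟩ := Nat.exists_eq_add_of_le' hk
        -- Solving `Δ(|x|² q) = Δp` in lower degree makes `p - |x|² q` harmonic.
        obtain ⟨q, hq, hq2⟩ := (ih i (by omega)).1 _ (polyLap_mem hp) 0
        refine ⟨p - polyNormSq * q, ⟨Submodule.sub_mem _ hp (polyNormSq_mul_mem hq), ?_⟩, i, rfl,
          q, hq, by ring⟩
        show polyLap (p - polyNormSq * q) = 0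
        rw [map_sub]
        rw [zero_add, pow_one, pow_zero, one_mul] at hq2
        rw [hq2, sub_self]
    refine ⟨fun p hp j => ?_, hdec⟩
    rcases hdec p hp with h | ⟨h, hh, i, rfl, q, hq, rfl⟩
    · obtain ⟨c, hc, hcj⟩ := exists_polyLap_normSq_pow_mul (parityPoly_isHomogeneous hp) h.2 j
      refine ⟨c⁻¹ • p, Submodule.smul_mem _ _ hp, ?_⟩
      rw [mul_smul_comm, map_smul, hcj, inv_smul_smul₀ hc.ne']
    · obtain ⟨c, hc, hcj⟩ := exists_polyLap_normSq_pow_mul (parityPoly_isHomogeneous hh.1) hh.2 j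
      -- The factor `|x|²` of the decomposition raises the power by one; this is why the statement
      -- is proved for all `j` at once.
      obtain ⟨q', hq', hq2⟩ := (ih i (by omega)).1 q hq (j + 1)
      refine ⟨c⁻¹ • h + polyNormSq * q', Submodule.add_mem _ (Submodule.smul_mem _ _ hh.1)
        (polyNormSq_mul_mem hq'), ?_⟩
      rw [mul_add, map_add, mul_smul_comm, map_smul, hcj, inv_smul_smul₀ hc.ne', ← mul_assoc,
        ← pow_succ, hq2]
      ring

theorem X_dvd_of_mem_restrictSupport {L : σ} {p : MvPolynomial σ ℝ}
    (hp : p ∈ restrictSupport ℝ {s : σ →₀ ℕ | s L ≠ 0}) : X L ∣ p := by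
  rw [← Ideal.mem_span_singleton]
  have : restrictSupport ℝ {s : σ →₀ ℕ | s L ≠ 0} ≤
      (Ideal.span {(X L : MvPolynomial σ ℝ)}).restrictScalars ℝ := by
    rw [restrictSupport_eq_span, Submodule.span_le]
    rintro _ ⟨s, hs, rfl⟩
    show monomial s (1 : ℝ) ∈ Ideal.span {(X L : MvPolynomial σ ℝ)}
    rw [Ideal.mem_span_singleton]
    have hs' : Finsupp.single L 1 ≤ s := by
      have : s L ≠ 0 := hs
      simpa using Nat.one_le_iff_ne_zero.mpr this
    obtain ⟨t, rfl⟩ := exists_add_of_le hs'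
    exact ⟨monomial t 1, by rw [X, monomial_mul, one_mul]⟩
  exact this hp

/-- The Dirichlet condition in algebraic form. The factor `X L` later absorbs the growth of the
gradient of the cutoff. -/
theorem X_dvd_of_odd {L : σ} {k : ℕ} {p : MvPolynomial σ ℝ} (hp : p ∈ parityPoly L 1 k) :
    X L ∣ p := by
  refine X_dvd_of_mem_restrictSupport (restrictSupport_mono ℝ (fun s hs => ?_) hp)
  have := hs.2
  show s L ≠ 0
  omega

/-- The Neumann condition in algebraic form: the normal derivative vanishes on the equator. -/
theorem X_dvd_pderiv_of_even {L : σ} {k : ℕ} {p : MvPolynomial σ ℝ} (hp : p ∈ parityPoly L 0 k) :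
    X L ∣ pderiv L p := by
  refine X_dvd_of_mem_restrictSupport ?_
  refine parityPoly_induction _ (pderiv L).toLinearMap (fun s hs => ?_) hp
  simp only [Derivation.coeFn_coe, pderiv_monomial]
  rw [monomial_mem_restrictSupport]
  have := hs.2
  rcases Nat.eq_zero_or_pos (s L) with h | h
  · right; simp [h]
  · left
    show (s - Finsupp.single L 1 : σ →₀ ℕ) L ≠ 0
    rw [Finsupp.tsub_apply, Finsupp.single_eq_same]
    omega

/-! #### Dimension count -/

theorem finite_degree_eq (k : ℕ) : {s : σ →₀ ℕ | s.degree = k}.Finite := by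
  refine (Finset.finite_toSet (Finset.finsuppAntidiag Finset.univ k)).subset fun s hs => ?_
  have : s.degree = k := hs
  simp [Finset.mem_finsuppAntidiag, ← this, Finsupp.degree_eq_sum]

theorem parityExps_finite (L : σ) (e k : ℕ) : (parityExps L e k).Finite :=
  (finite_degree_eq k).subset fun _ hs => hs.1

instance (L : σ) (e k : ℕ) : Module.Finite ℝ (parityPoly L e k) := by
  have := (parityExps_finite L e k).to_subtype
  exact Module.Finite.of_basis (basisRestrictSupport ℝ (parityExps L e k))

theorem finrank_parityPoly (L : σ) (e k : ℕ) :
    Module.finrank ℝ (parityPoly L e k) = (parityExps L e k).ncard :=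
  Module.finrank_eq_nat_card_basis (basisRestrictSupport ℝ (parityExps L e k))

/-- Erasing the entry at `L` leaves the exponents of degree `k` in the other variables, counted by
stars and bars. -/
theorem ncard_fixed (L : σ) (e k : ℕ) :
    {s : σ →₀ ℕ | s.degree = k + e ∧ s L = e}.ncard = (Fintype.card σ - 1 + k - 1).choose k := by
  have h : {s : σ →₀ ℕ | s.degree = k + e ∧ s L = e} = (fun t => t + Finsupp.single L e) ''
      (Finset.finsuppAntidiag (Finset.univ.erase L) k : Set (σ →₀ ℕ)) := by
    ext s
    simp only [Set.mem_ofPred_eq, Set.mem_image, Finset.mem_coe, Finset.mem_finsuppAntidiag]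
    constructor
    · rintro ⟨h1, h2⟩
      refine ⟨s.erase L, ⟨?_, ?_⟩, ?_⟩
      · rw [Finsupp.degree_eq_sum, ← Finset.add_sum_erase _ _ (Finset.mem_univ L), h2] at h1
        have : ∑ x ∈ Finset.univ.erase L, (s.erase L) x = ∑ x ∈ Finset.univ.erase L, s x :=
          Finset.sum_congr rfl fun i hi => Finsupp.erase_ne (Finset.ne_of_mem_erase hi)
        show ∑ x ∈ Finset.univ.erase L, (s.erase L) x = k
        omega
      · rw [Finsupp.support_erase]
        exact Finset.erase_subset_erase _ (Finset.subset_univ _)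
      · rw [← h2]; exact Finsupp.erase_add_single L s
    · rintro ⟨t, ⟨h1, h2⟩, rfl⟩
      have h0 : t L = 0 := by
        by_contra hne
        have := h2 (Finsupp.mem_support_iff.mpr hne)
        simp at this
      refine ⟨?_, by simp [h0]⟩
      rw [map_add, Finsupp.degree_single, Finsupp.degree_eq_sum,
        ← Finset.add_sum_erase _ _ (Finset.mem_univ L), h0, zero_add]
      exact congrArg (· + e) h1
  rw [h, Set.ncard_image_of_injective _ (add_left_injective _), Set.ncard_coe_finset,
    Finset.card_finsuppAntidiag_nat_eq_choose, Finset.card_erase_of_mem (Finset.mem_univ L),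
    Finset.card_univ]

theorem ncard_parityExps_add_two (L : σ) (e k : ℕ) (he : e < 2) :
    (parityExps L e (k + 2)).ncard =
      (parityExps L e k).ncard + {s : σ →₀ ℕ | s.degree = k + 2 ∧ s L = e}.ncard := by
  have h : parityExps L e (k + 2) = (fun t => t + Finsupp.single L 2) '' (parityExps L e k) ∪
      {s : σ →₀ ℕ | s.degree = k + 2 ∧ s L = e} := by
    ext s
    simp only [parityExps, Set.mem_ofPred_eq, Set.mem_union, Set.mem_image]
    constructor
    · rintro ⟨h1, h2⟩
      rcases lt_or_ge (s L) 2 with h3 | h3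
      · right; exact ⟨h1, by omega⟩
      · left
        obtain ⟨t, rfl⟩ := exists_add_of_le (show Finsupp.single L 2 ≤ s by simpa using h3)
        refine ⟨t, ⟨?_, ?_⟩, add_comm _ _⟩
        · rw [map_add, Finsupp.degree_single] at h1; omega
        · rw [Finsupp.add_apply, Finsupp.single_eq_same] at h2; omega
    · rintro (⟨t, ⟨h1, h2⟩, rfl⟩ | ⟨h1, h2⟩)
      · refine ⟨?_, ?_⟩
        · rw [map_add, Finsupp.degree_single]; omega
        · rw [Finsupp.add_apply, Finsupp.single_eq_same]; omega
      · exact ⟨h1, by omega⟩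
  rw [h, Set.ncard_union_eq ?_ ((parityExps_finite L e k).image _)
    ((finite_degree_eq (k + 2)).subset fun _ hs => hs.1),
    Set.ncard_image_of_injective _ (add_left_injective _)]
  rw [Set.disjoint_left]
  rintro _ ⟨t, _, rfl⟩ ⟨_, h2⟩
  simp only [Finsupp.add_apply, Finsupp.single_eq_same] at h2
  omega

/-- Rank-nullity for the Laplacian, which is onto the polynomials of degree `k` of the same parity.
-/
theorem finrank_parityHarmonic_add_two (L : σ) (e k : ℕ) :
    Module.finrank ℝ (parityHarmonic L e (k + 2)) + Module.finrank ℝ (parityPoly L e k) =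
      Module.finrank ℝ (parityPoly L e (k + 2)) := by
  let f : parityPoly L e (k + 2) →ₗ[ℝ] parityPoly L e k :=
    (polyLap.comp (parityPoly L e (k + 2)).subtype).codRestrict (parityPoly L e k)
      fun p => polyLap_mem p.2
  have hsurj : LinearMap.range f = ⊤ := by
    rw [LinearMap.range_eq_top]
    rintro ⟨p, hp⟩
    obtain ⟨q, hq, h⟩ := (exists_polyLap_eq_and_decomposition L e k).1 p hp 0
    refine ⟨⟨polyNormSq * q, polyNormSq_mul_mem hq⟩, Subtype.ext ?_⟩
    show polyLap (polyNormSq * q) = p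
    simpa using h
  have hker : (LinearMap.ker f).map (parityPoly L e (k + 2)).subtype = parityHarmonic L e (k + 2) := by
    ext p
    simp only [Submodule.mem_map, LinearMap.mem_ker, Submodule.subtype_apply, parityHarmonic,
      Submodule.mem_inf]
    constructor
    · rintro ⟨q, hq, rfl⟩
      exact ⟨q.2, congrArg Subtype.val hq⟩
    · rintro ⟨h1, h2⟩
      exact ⟨⟨p, h1⟩, Subtype.ext h2, rfl⟩
  have h := LinearMap.finrank_range_add_finrank_ker f
  rw [hsurj, finrank_top] at h
  rw [← hker, LinearEquiv.finrank_eq (Submodule.equivMapOfInjective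
    (parityPoly L e (k + 2)).subtype (Submodule.injective_subtype _) (LinearMap.ker f)).symm]
  omega

theorem parityHarmonic_eq_of_lt {L : σ} {e k : ℕ} (hk : k < 2) :
    parityHarmonic L e k = parityPoly L e k :=
  inf_eq_left.mpr fun _ hp => polyLap_eq_zero_of_degree_lt hk hp

/-- The exponents of degree `k + 2` with entry at least two at `L` correspond to those of degree
`k`; rank-nullity cancels them and leaves the entry `e`. This reflects that a harmonic polynomial is
determined by its Cauchy data on `x_L = 0`, of which parity keeps one half. -/
theorem finrank_parityHarmonic_eq_ncard (L : σ) (e k : ℕ) (he : e < 2) :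
    Module.finrank ℝ (parityHarmonic L e k) = {s : σ →₀ ℕ | s.degree = k ∧ s L = e}.ncard := by
  rcases lt_or_ge k 2 with hk | hk
  · rw [parityHarmonic_eq_of_lt hk, finrank_parityPoly]
    congr 1
    ext s
    simp only [parityExps, Set.mem_ofPred_eq, and_congr_right_iff]
    intro hs
    have : s L ≤ s.degree := Finsupp.le_degree L s
    omega
  · obtain ⟨i, rfl⟩ := Nat.exists_eq_add_of_le' hk
    have h := finrank_parityHarmonic_add_two L e i
    rw [finrank_parityPoly, finrank_parityPoly, ncard_parityExps_add_two L e i he] at h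
    omega

theorem finrank_evenHarmonic (n k : ℕ) (L : Fin (n + 2)) :
    Module.finrank ℝ (parityHarmonic L 0 k) = (k + n).choose n := by
  rw [finrank_parityHarmonic_eq_ncard L 0 k (by omega)]
  refine (ncard_fixed L 0 k).trans ?_
  rw [Fintype.card_fin]
  have e : n + 2 - 1 + k - 1 = k + n := by omega
  rw [e]
  exact Nat.choose_symm_add

theorem finrank_oddHarmonic_succ (n k : ℕ) (L : Fin (n + 2)) :
    Module.finrank ℝ (parityHarmonic L 1 (k + 1)) = (k + n).choose n := by
  rw [finrank_parityHarmonic_eq_ncard L 1 (k + 1) (by omega), ncard_fixed L 1 k, Fintype.card_fin]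
  have e : n + 2 - 1 + k - 1 = k + n := by omega
  rw [e]
  exact Nat.choose_symm_add

theorem finrank_oddHarmonic_zero (L : σ) : Module.finrank ℝ (parityHarmonic L 1 0) = 0 := by
  rw [finrank_parityHarmonic_eq_ncard L 1 0 (by omega)]
  have : {s : σ →₀ ℕ | s.degree = 0 ∧ s L = 1} = ∅ := by
    ext s
    simp only [Set.mem_ofPred_eq, Set.mem_empty_iff_false, iff_false, not_and]
    intro hs
    have : s L ≤ s.degree := Finsupp.le_degree L s
    omega
  rw [this, Set.ncard_empty]

end Harmonic

/-! ### The divergence theorem on the sphere -/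

section Divergence

variable {E : Type*} [NormedAddCommGroup E] [InnerProductSpace ℝ E]

theorem integral_polar_mul [Nontrivial E] [FiniteDimensional ℝ E] [MeasurableSpace E] [BorelSpace E]
    (μ : Measure E) [μ.IsAddHaarMeasure] (a : ℝ → ℝ) (b : Metric.sphere (0 : E) 1 → ℝ) (F : E → ℝ)
    (hF : ∀ x : E, ∀ y : Metric.sphere (0 : E) 1, ‖x‖⁻¹ • x = y → x ≠ 0 → F x = b y * a ‖x‖) :
    ∫ x, F x ∂μ = (∫ y, b y ∂μ.toSphere) *
      ∫ t : Set.Ioi (0 : ℝ), a t ∂(Measure.volumeIoiPow (Module.finrank ℝ E - 1)) := by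
  calc
    ∫ x, F x ∂μ = ∫ x : ({(0)}ᶜ : Set E), F x.1 ∂(μ.comap (↑)) := by
      rw [integral_subtype_comap (measurableSet_singleton _).compl F, restrict_compl_singleton]
    _ = ∫ x : ({(0)}ᶜ : Set E), b (homeomorphUnitSphereProd E x).1 *
          a (homeomorphUnitSphereProd E x).2 ∂(μ.comap (↑)) := by
      refine integral_congr_ae (Eventually.of_forall fun x => ?_)
      have := hF x.1 (homeomorphUnitSphereProd E x).1 (by simp) x.2
      simpa using this
    _ = ∫ p, b p.1 * a p.2 ∂μ.toSphere.prod (.volumeIoiPow (Module.finrank ℝ E - 1)) :=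
      μ.measurePreserving_homeomorphUnitSphereProd.integral_comp
        (Homeomorph.measurableEmbedding _) fun p => b p.1 * a p.2
    _ = _ := integral_prod_mul b fun t : Set.Ioi (0 : ℝ) => a t

theorem integral_fderiv_eq_zero [FiniteDimensional ℝ E] [MeasurableSpace E] [BorelSpace E]
    (μ : Measure E) [μ.IsAddHaarMeasure] {f : E → ℝ} (hf : ContDiff ℝ 1 f) (hc : HasCompactSupport f)
    (v : E) : ∫ x, fderiv ℝ f x v ∂μ = 0 := by
  have h1 : Integrable (fun x => fderiv ℝ f x v) μ :=
    ((hf.continuous_fderiv one_ne_zero).clm_apply continuous_const).integrable_of_hasCompactSupport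
      (hc.fderiv_apply ℝ v)
  have h2 : Integrable f μ := hf.continuous.integrable_of_hasCompactSupport hc
  have h := integral_mul_fderiv_eq_neg_fderiv_mul_of_integrable (μ := μ) (f := fun _ : E => (1 : ℝ))
    (g := f) (v := v) (by simp) (by simpa using h1) (by simpa using h2)
    (fun x _ => differentiableAt_const _) (fun x _ => hf.differentiable one_ne_zero x)
  simpa using h

/-- The integral of the trace of the derivative of a compactly supported field vanishes. -/
theorem integral_trace_fderiv_eq_zero [FiniteDimensional ℝ E] [MeasurableSpace E] [BorelSpace E]
    (μ : Measure E) [μ.IsAddHaarMeasure] {Y : E → E} (hY : ContDiff ℝ 1 Y)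
    (hc : HasCompactSupport Y) :
    ∫ x, LinearMap.trace ℝ E (fderiv ℝ Y x : E →ₗ[ℝ] E) ∂μ = 0 := by
  let b := stdOrthonormalBasis ℝ E
  have hs : ∀ i, ContDiff ℝ 1 (fun x => inner ℝ (b i) (Y x)) := fun i => contDiff_const.inner ℝ hY
  have hcs : ∀ i, HasCompactSupport (fun x => inner ℝ (b i) (Y x)) := fun i =>
    hc.comp_left (g := fun y => inner ℝ (b i) y) (inner_zero_right _)
  have h : ∀ x, LinearMap.trace ℝ E (fderiv ℝ Y x : E →ₗ[ℝ] E) =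
      ∑ i, fderiv ℝ (fun x => inner ℝ (b i) (Y x)) x (b i) := by
    intro x
    rw [LinearMap.trace_eq_sum_inner _ b]
    refine Finset.sum_congr rfl fun i _ => ?_
    have hd : HasFDerivAt Y (fderiv ℝ Y x) x := (hY.differentiable one_ne_zero x).hasFDerivAt
    have h3 := ((innerSL ℝ (b i)).hasFDerivAt (x := Y x)).comp x hd
    have h4 : fderiv ℝ (fun x => inner ℝ (b i) (Y x)) x = (innerSL ℝ (b i)).comp (fderiv ℝ Y x) :=
      h3.fderiv
    rw [h4]; rfl
  simp_rw [h]
  rw [integral_finsetSum]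
  · exact Finset.sum_eq_zero fun i _ => integral_fderiv_eq_zero μ (hs i) (hcs i) _
  · intro i _
    exact (((hs i).continuous_fderiv one_ne_zero).clm_apply
      continuous_const).integrable_of_hasCompactSupport ((hcs i).fderiv_apply ℝ _)

theorem hasFDerivAt_norm {x : E} (hx : x ≠ 0) :
    HasFDerivAt (fun y : E => ‖y‖) (innerSL ℝ (‖x‖⁻¹ • x)) x := by
  have h := (hasStrictFDerivAt_norm_sq x).hasFDerivAt.sqrt (by simpa using hx)
  have e : (fun y : E => Real.sqrt (‖y‖ ^ 2)) = fun y => ‖y‖ := by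
    funext y; exact Real.sqrt_sq (norm_nonneg y)
  rw [e] at h
  refine h.congr_fderiv ?_
  ext v
  have : ‖x‖ ≠ 0 := norm_ne_zero_iff.mpr hx
  simp [Real.sqrt_sq (norm_nonneg x)]
  field_simp

theorem hasFDerivAt_normalize {x : E} (hx : x ≠ 0) :
    HasFDerivAt (fun y : E => ‖y‖⁻¹ • y) (‖x‖⁻¹ • (ContinuousLinearMap.id ℝ E -
      (innerSL ℝ (‖x‖⁻¹ • x)).smulRight (‖x‖⁻¹ • x))) x := by
  have hn : ‖x‖ ≠ 0 := norm_ne_zero_iff.mpr hx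
  have h := (((hasDerivAt_inv hn).comp_hasFDerivAt x (hasFDerivAt_norm hx))).smul (hasFDerivAt_id x)
  refine h.congr_fderiv ?_
  ext v
  simp [smul_smul, sub_eq_add_neg]
  field_simp

variable (χ : ContDiffBump (1 : ℝ)) (X : E → E)

/-- The field `x ↦ χ(|x|) X(x/|x|)`. -/
def radialExtension (x : E) : E := χ ‖x‖ • X (‖x‖⁻¹ • x)

theorem bump_eq_zero_of_le (hχ : χ.rOut ≤ 1 / 2) {t : ℝ} (ht : t ≤ 1 / 2) : χ t = 0 := by
  refine χ.zero_of_le_dist ?_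
  rw [Real.dist_eq, abs_of_nonpos (by linarith)]
  linarith

variable {X}

theorem contDiff_radialExtension (hχ : χ.rOut ≤ 1 / 2) (hX : ContDiff ℝ 1 X) :
    ContDiff ℝ 1 (radialExtension χ X) := by
  rw [contDiff_iff_contDiffAt]
  intro x
  by_cases hx : x = 0
  · subst hx
    have : radialExtension χ X =ᶠ[nhds 0] fun _ => 0 := by
      filter_upwards [Metric.ball_mem_nhds (0 : E) (by norm_num : (0 : ℝ) < 1 / 2)] with y hy
      rw [mem_ball_zero_iff] at hy
      rw [radialExtension, bump_eq_zero_of_le χ hχ hy.le, zero_smul]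
    exact contDiffAt_const.congr_of_eventuallyEq this
  · have hn : ContDiffAt ℝ 1 (fun y : E => ‖y‖) x := contDiffAt_norm ℝ hx
    have h1 : ContDiffAt ℝ 1 (fun y : E => χ ‖y‖) x := (χ.contDiffAt (n := 1)).comp x hn
    have h2 : ContDiffAt ℝ 1 (fun y : E => ‖y‖⁻¹ • y) x :=
      (hn.inv (norm_ne_zero_iff.mpr hx)).smul contDiffAt_id
    exact h1.smul (hX.contDiffAt.comp x h2)

theorem hasCompactSupport_comp_norm [FiniteDimensional ℝ E] :
    HasCompactSupport (fun x : E => χ ‖x‖) := by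
  refine HasCompactSupport.intro (isCompact_closedBall (0 : E) (1 + χ.rOut)) fun x hx => ?_
  rw [mem_closedBall_zero_iff, not_le] at hx
  refine χ.zero_of_le_dist ?_
  rw [Real.dist_eq]
  exact le_trans (by linarith) (le_abs_self _)

/-- The derivative of `χ` contributes a rank-one map of trace proportional to `⟨u, X u⟩ = 0`. What
remains is a function of the direction times a function of the radius. -/
theorem trace_fderiv_radialExtension [FiniteDimensional ℝ E] (hX : ContDiff ℝ 1 X)
    {x : E} (hx : x ≠ 0) (ht : inner ℝ (X (‖x‖⁻¹ • x)) (‖x‖⁻¹ • x) = 0) :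
    LinearMap.trace ℝ E (fderiv ℝ (radialExtension χ X) x : E →ₗ[ℝ] E) =
      (LinearMap.trace ℝ E (fderiv ℝ X (‖x‖⁻¹ • x) : E →ₗ[ℝ] E) -
        inner ℝ (fderiv ℝ X (‖x‖⁻¹ • x) (‖x‖⁻¹ • x)) (‖x‖⁻¹ • x)) * (χ ‖x‖ * ‖x‖⁻¹) := by
  set u := ‖x‖⁻¹ • x with hu
  have hχd : HasDerivAt χ (deriv χ ‖x‖) ‖x‖ :=
    ((χ.contDiff (n := 1)).differentiable one_ne_zero ‖x‖).hasDerivAt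
  have h1 := hχd.comp_hasFDerivAt x (hasFDerivAt_norm hx)
  have hXd : HasFDerivAt X (fderiv ℝ X u) (‖x‖⁻¹ • x) :=
    (hX.differentiable one_ne_zero u).hasFDerivAt
  have h2 := HasFDerivAt.comp (f := fun y : E => ‖y‖⁻¹ • y) x hXd (hasFDerivAt_normalize hx)
  have h3 : HasFDerivAt (radialExtension χ X) ((χ ‖x‖ * ‖x‖⁻¹) • (fderiv ℝ X u -
        (innerSL ℝ u).smulRight (fderiv ℝ X u u)) +
      deriv χ ‖x‖ • (innerSL ℝ u).smulRight (X u)) x := by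
    refine (h1.smul h2).congr_fderiv ?_
    rw [← hu]
    clear_value u
    ext v
    show χ ‖x‖ • (fderiv ℝ X u) (‖x‖⁻¹ • (v - inner ℝ u v • u)) +
        (deriv χ ‖x‖ * inner ℝ u v) • X (‖x‖⁻¹ • x) =
      (χ ‖x‖ * ‖x‖⁻¹) • (fderiv ℝ X u v - inner ℝ u v • fderiv ℝ X u u) +
        deriv χ ‖x‖ • inner ℝ u v • X u
    rw [← hu, map_smul, map_sub, map_smul, mul_smul, mul_smul]
  have e : (((χ ‖x‖ * ‖x‖⁻¹) • (fderiv ℝ X u - (innerSL ℝ u).smulRight (fderiv ℝ X u u)) +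
      deriv χ ‖x‖ • (innerSL ℝ u).smulRight (X u) : E →L[ℝ] E) : E →ₗ[ℝ] E) =
      (χ ‖x‖ * ‖x‖⁻¹) • ((fderiv ℝ X u : E →ₗ[ℝ] E) -
        ((innerSL ℝ u : E →L[ℝ] ℝ) : E →ₗ[ℝ] ℝ).smulRight (fderiv ℝ X u u)) +
      deriv χ ‖x‖ • ((innerSL ℝ u : E →L[ℝ] ℝ) : E →ₗ[ℝ] ℝ).smulRight (X u) := rfl
  rw [h3.fderiv, e]
  rw [map_add, LinearMap.map_smul (LinearMap.trace ℝ E), LinearMap.map_smul (LinearMap.trace ℝ E),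
    map_sub, LinearMap.trace_smulRight, LinearMap.trace_smulRight]
  have e2 : ((innerSL ℝ u : E →L[ℝ] ℝ) : E →ₗ[ℝ] ℝ) (X u) = 0 := by
    rw [← ht, real_inner_comm]; rfl
  have e3 : ((innerSL ℝ u : E →L[ℝ] ℝ) : E →ₗ[ℝ] ℝ) (fderiv ℝ X u u) =
    inner ℝ (fderiv ℝ X u u) u := by
    rw [real_inner_comm]; rfl
  rw [e2, e3]
  simp only [smul_eq_mul]
  ring

end Divergence

/-- Stokes' theorem on the sphere is deduced from the Euclidean one: the divergence of
`radialExtension χ X` has integral zero, and in polar coordinates this integral is the spherical one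
times a nonzero radial factor. -/
theorem integral_sphDiv_eq_zero {d : ℕ} {X : Amb d → Amb d} (hX : ContDiff ℝ 1 X)
    (ht : ∀ x : Sph d, inner ℝ (X x) (x : Amb d) = 0) : ∫ x : Sph d, sphDiv X x ∂(surf d) = 0 := by
  let χ : ContDiffBump (1 : ℝ) := ⟨1 / 4, 1 / 2, by norm_num, by norm_num⟩
  have hχ : χ.rOut ≤ 1 / 2 := le_refl _
  have hcpt : HasCompactSupport (fun x : Amb d => χ ‖x‖) := hasCompactSupport_comp_norm χ
  have h1 := integral_polar_mul (volume : Measure (Amb d)) (fun t => χ t * t⁻¹)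
    (fun y : Sph d => sphDiv X y)
    (fun x => LinearMap.trace ℝ (Amb d) (fderiv ℝ (radialExtension χ X) x : Amb d →ₗ[ℝ] Amb d))
    (fun x y hxy hx => by
      have := trace_fderiv_radialExtension χ hX hx (by rw [hxy]; exact ht y)
      rw [hxy] at this
      exact this)
  rw [integral_trace_fderiv_eq_zero _ (contDiff_radialExtension χ hχ hX) hcpt.smul_right] at h1
  -- The same factorisation with constant angular part shows that the radial factor is nonzero,
  -- without computing it.
  have h2 := integral_polar_mul (volume : Measure (Amb d)) (fun t => χ t * t⁻¹)
    (fun _ : Sph d => 1) (fun x => χ ‖x‖ * ‖x‖⁻¹) (fun x y _ _ => by rw [one_mul])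
  have hpos : 0 < ∫ x : Amb d, χ ‖x‖ * ‖x‖⁻¹ := by
    have hcont : Continuous fun x : Amb d => χ ‖x‖ * ‖x‖⁻¹ := by
      rw [continuous_iff_continuousAt]
      intro x
      by_cases hx : x = 0
      · subst hx
        refine (continuousAt_const (y := (0 : ℝ))).congr ?_
        filter_upwards [Metric.ball_mem_nhds (0 : Amb d) (by norm_num : (0 : ℝ) < 1 / 2)] with y hy
        rw [mem_ball_zero_iff] at hy
        rw [bump_eq_zero_of_le χ hχ hy.le, zero_mul]
      · exact ((χ.continuous.comp continuous_norm).continuousAt).mul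
          (continuous_norm.continuousAt.inv₀ (norm_ne_zero_iff.mpr hx))
    refine hcont.integral_pos_of_hasCompactSupport_nonneg_nonzero (x := EuclideanSpace.single 0 1)
      hcpt.mul_right (fun x => mul_nonneg χ.nonneg (by positivity)) ?_
    have h1 : ‖(EuclideanSpace.single 0 1 : Amb d)‖ = 1 := by simp
    rw [h1, χ.one_of_mem_closedBall (Metric.mem_closedBall_self χ.rIn_pos.le)]
    norm_num
  rw [h2] at hpos
  have hne : ∫ t : Set.Ioi (0 : ℝ), χ t * (t : ℝ)⁻¹
      ∂(Measure.volumeIoiPow (Module.finrank ℝ (Amb d) - 1)) ≠ 0 := right_ne_zero_of_mul hpos.ne'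
  exact (mul_eq_zero.mp h1.symm).resolve_right hne

/-! ### Calculus on the hemisphere -/

theorem isOpen_upperHalf (d : ℕ) : IsOpen (upperHalf d) :=
  isOpen_lt continuous_const (by fun_prop)

theorem isOpen_hemi (d : ℕ) : IsOpen (hemi d) :=
  (isOpen_upperHalf d).preimage continuous_subtype_val

theorem ae_mem_upperHalf (d : ℕ) : ∀ᵐ x : Sph d ∂(hemiMeas d), (x : Amb d) ∈ upperHalf d :=
  ae_restrict_mem (isOpen_hemi d).measurableSet

theorem norm_coe_sph {d : ℕ} (x : Sph d) : ‖(x : Amb d)‖ = 1 := norm_eq_of_mem_sphere x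

theorem continuous_gradient {d : ℕ} {f : Amb d → ℝ} (hf : ContDiff ℝ 1 f) :
    Continuous (gradient f) := by
  unfold gradient
  exact (LinearIsometryEquiv.continuous _).comp (hf.continuous_fderiv one_ne_zero)

theorem continuous_sphGrad {d : ℕ} {f : Amb d → ℝ} (hf : ContDiff ℝ 1 f) :
    Continuous (sphGrad f) := by
  have h := continuous_gradient hf
  unfold sphGrad
  fun_prop

theorem continuous_sphDiv {d : ℕ} {X : Amb d → Amb d} (hX : ContDiff ℝ 1 X) :
    Continuous (sphDiv X) := by
  have hD := hX.continuous_fderiv one_ne_zero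
  have ht : Continuous (fun A : Amb d →L[ℝ] Amb d =>
      LinearMap.trace ℝ (Amb d) (A : Amb d →ₗ[ℝ] Amb d)) :=
    LinearMap.continuous_of_finiteDimensional
      ((LinearMap.trace ℝ (Amb d)).comp (ContinuousLinearMap.coeLM ℝ))
  exact (ht.comp hD).sub ((hD.clm_apply continuous_id).inner continuous_id)

theorem inner_sphGrad {d : ℕ} (f : Amb d → ℝ) {x v : Amb d} (hv : inner ℝ v x = 0) :
    inner ℝ (sphGrad f x) v = fderiv ℝ f x v := by
  rw [sphGrad, inner_sub_left, inner_gradient_left, real_inner_smul_left, real_inner_comm v x, hv,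
    mul_zero, sub_zero]

theorem inner_sphGrad_self {d : ℕ} (f : Amb d → ℝ) {x : Amb d} (hx : ‖x‖ = 1) :
    inner ℝ (sphGrad f x) x = 0 := by
  rw [sphGrad, inner_sub_left, real_inner_smul_left, real_inner_self_eq_norm_sq, hx,
    real_inner_comm]
  ring

theorem sphDiv_smul {d : ℕ} {f : Amb d → ℝ} {X : Amb d → Amb d} {x : Amb d}
    (hf : DifferentiableAt ℝ f x) (hX : DifferentiableAt ℝ X x) (ht : inner ℝ (X x) x = 0) :
    sphDiv (fun y => f y • X y) x = f x * sphDiv X x + fderiv ℝ f x (X x) := by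
  have h := (hf.hasFDerivAt.smul hX.hasFDerivAt).fderiv
  have h' : fderiv ℝ (fun y => f y • X y) x = f x • fderiv ℝ X x +
    (fderiv ℝ f x).smulRight (X x) := h
  have e : ((f x • fderiv ℝ X x + (fderiv ℝ f x).smulRight (X x) : Amb d →L[ℝ] Amb d) :
      Amb d →ₗ[ℝ] Amb d) = f x • (fderiv ℝ X x : Amb d →ₗ[ℝ] Amb d) +
      (fderiv ℝ f x : Amb d →ₗ[ℝ] ℝ).smulRight (X x) := rfl
  rw [sphDiv, sphDiv, h', e, map_add, LinearMap.map_smul (LinearMap.trace ℝ (Amb d)),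
    LinearMap.trace_smulRight]
  have e2 : (f x • fderiv ℝ X x + (fderiv ℝ f x).smulRight (X x) : Amb d →L[ℝ] Amb d) x =
      f x • fderiv ℝ X x x + fderiv ℝ f x x • X x := rfl
  rw [e2, inner_add_left, real_inner_smul_left, real_inner_smul_left, ht]
  simp only [smul_eq_mul, ContinuousLinearMap.coe_coe]
  ring

theorem continuousOn_sph_bound {d : ℕ} {F : Type*} [NormedAddCommGroup F] {f : Amb d → F}
    (hf : Continuous f) : ∃ C, ∀ x : Sph d, ‖f x‖ ≤ C := by
  obtain ⟨C, hC⟩ := (isCompact_univ (X := Sph d)).exists_bound_of_continuousOn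
    (hf.comp continuous_subtype_val).continuousOn
  exact ⟨C, fun x => hC x (Set.mem_univ x)⟩

theorem integrable_sph {d : ℕ} {f : Amb d → ℝ} (hf : Continuous f) :
    Integrable (fun x : Sph d => f x) (hemiMeas d) := by
  obtain ⟨C, hC⟩ := continuousOn_sph_bound hf
  exact (integrable_const C).mono' (hf.comp continuous_subtype_val).aestronglyMeasurable
    (Eventually.of_forall hC)

/-- Integration by parts on the hemisphere. -/
theorem integral_mul_sphDiv {d : ℕ} {f : Amb d → ℝ} {X : Amb d → Amb d} (hf : ContDiff ℝ ∞ f)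
    (hX : ContDiff ℝ ∞ X) (ht : ∀ x : Sph d, inner ℝ (X x) (x : Amb d) = 0)
    (hs : tsupport (fun x => f x • X x) ⊆ upperHalf d) :
    ∫ x, f x * sphDiv X x ∂(hemiMeas d) = - ∫ x, inner ℝ (sphGrad f x) (X x) ∂(hemiMeas d) := by
  have hf1 : ContDiff ℝ 1 f := hf.of_le (by exact_mod_cast le_top)
  have hX1 : ContDiff ℝ 1 X := hX.of_le (by exact_mod_cast le_top)
  have h := integral_sphDiv_eq_zero (hf1.smul hX1) (fun x => by
    show inner ℝ (f x • X x) (x : Amb d) = 0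
    rw [real_inner_smul_left, ht, mul_zero])
  -- Since `f X` is supported in the open half-space, the vanishing integral over the whole sphere
  -- is the integral over the hemisphere, and no boundary term appears.
  have hz : ∀ x : Sph d, x ∉ hemi d → sphDiv (fun x => f x • X x) x = 0 := by
    intro x hx
    have hx' : (x : Amb d) ∉ tsupport (fun x => f x • X x) := fun hmem => hx (hs hmem)
    have : fderiv ℝ (fun x => f x • X x) (x : Amb d) = 0 := by
      by_contra hne
      exact hx' (support_fderiv_subset ℝ hne)
    rw [sphDiv, this]
    simp
  have h2 : ∫ x, sphDiv (fun x => f x • X x) x ∂(hemiMeas d) = 0 := by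
    rw [hemiMeas, setIntegral_eq_integral_of_forall_compl_eq_zero hz]
    exact h
  have h3 : ∀ x : Sph d, sphDiv (fun x => f x • X x) x =
      f x * sphDiv X x + inner ℝ (sphGrad f x) (X x) := by
    intro x
    rw [sphDiv_smul (hf1.differentiable one_ne_zero x) (hX1.differentiable one_ne_zero x) (ht x),
      inner_sphGrad f (ht x)]
  simp_rw [h3] at h2
  rw [integral_add] at h2
  · linarith
  · exact integrable_sph (f := fun x => f x * sphDiv X x) (hf1.continuous.mul (continuous_sphDiv hX1))
  · exact integrable_sph (f := fun x => inner ℝ (sphGrad f x) (X x))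
      ((continuous_sphGrad hf1).inner hX1.continuous)

/-! #### Continuous functions as elements of `L²(S^d_+)` -/

section Lp

variable {d : ℕ} {F : Type*} [NormedAddCommGroup F] [NormedSpace ℝ F]

/-- The class in `L²(S^d_+)` of a continuous function on `ℝ^{d+1}`. -/
def sphLp (f : Amb d → F) (hf : Continuous f) : Lp F 2 (hemiMeas d) :=
  ContinuousMap.toLp 2 (hemiMeas d) ℝ ⟨fun x : Sph d => f x, hf.comp continuous_subtype_val⟩

theorem coeFn_sphLp (f : Amb d → F) (hf : Continuous f) :
    ∀ᵐ x ∂(hemiMeas d), sphLp f hf x = f x :=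
  ContinuousMap.coeFn_toLp (hemiMeas d) (𝕜 := ℝ) _

theorem tendsto_sphLp {f : ℕ → Amb d → F} {g : Amb d → F} (hf : ∀ n, Continuous (f n))
    (hg : Continuous g) {C : ℝ} (hC : ∀ n, ∀ x : Sph d, (x : Amb d) ∈ upperHalf d → ‖f n x‖ ≤ C)
    (hlim : ∀ x : Sph d, (x : Amb d) ∈ upperHalf d → Tendsto (fun n => f n x) atTop (nhds (g x))) :
    Tendsto (fun n => sphLp (f n) (hf n)) atTop (nhds (sphLp g hg)) := by
  rw [Lp.tendsto_Lp_iff_tendsto_eLpNorm']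
  have hb : ∀ x : Sph d, (x : Amb d) ∈ upperHalf d → ‖g x‖ ≤ C := fun x hx =>
    le_of_tendsto ((hlim x hx).norm) (Eventually.of_forall fun n => hC n x hx)
  have key : Tendsto (fun n => ∫⁻ x, ‖f n x - g x‖ₑ ^ (2 : ℝ) ∂(hemiMeas d)) atTop
      (nhds (∫⁻ _, 0 ∂(hemiMeas d))) := by
    refine tendsto_lintegral_of_dominated_convergence' (fun _ => ENNReal.ofReal (2 * C) ^ (2 : ℝ))
      (fun n => ?_) (fun n => ?_) ?_ ?_
    · exact ((((hf n).sub hg).comp continuous_subtype_val).enorm.measurable.pow_const _).aemeasurable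
    · filter_upwards [ae_mem_upperHalf d] with x hx
      gcongr
      rw [← ofReal_norm]
      refine ENNReal.ofReal_le_ofReal ((norm_sub_le _ _).trans ?_)
      linarith [hC n x hx, hb x hx]
    · rw [lintegral_const]
      exact ENNReal.mul_ne_top (ENNReal.rpow_ne_top_of_nonneg (by norm_num) ENNReal.ofReal_ne_top)
        (measure_ne_top _ _)
    · filter_upwards [ae_mem_upperHalf d] with x hx
      have h1 : Tendsto (fun n => ‖f n x - g x‖ₑ) atTop (nhds ‖g x - g x‖ₑ) :=
        ((hlim x hx).sub_const _).enorm
      rw [sub_self, enorm_zero] at h1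
      have h2 := (ENNReal.continuous_rpow_const (y := 2)).tendsto 0 |>.comp h1
      simpa [Function.comp_def] using h2
  rw [lintegral_zero] at key
  have key2 := (ENNReal.continuous_rpow_const (y := 1 / 2)).tendsto 0 |>.comp key
  rw [ENNReal.zero_rpow_of_pos (by norm_num)] at key2
  refine key2.congr fun n => ?_
  rw [eLpNorm_eq_lintegral_rpow_enorm_toReal (by norm_num) (by norm_num)]
  simp only [ENNReal.toReal_ofNat, Function.comp_apply]
  congr 1
  refine lintegral_congr_ae ?_
  filter_upwards [coeFn_sphLp (f n) (hf n), coeFn_sphLp g hg] with x h1 h2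
  rw [Pi.sub_apply, h1, h2]

end Lp

theorem inner_sphLp_left {d : ℕ} {F : Type*} [NormedAddCommGroup F] [InnerProductSpace ℝ F]
    (f : Amb d → F) (hf : Continuous f) (u : Lp F 2 (hemiMeas d)) :
    inner ℝ (sphLp f hf) u = ∫ x, inner ℝ (f x) (u x) ∂(hemiMeas d) := by
  rw [L2.inner_def]
  refine integral_congr_ae ?_
  filter_upwards [coeFn_sphLp f hf] with x h
  rw [h]

theorem sphLp_mem_H1 {d : ℕ} {f : Amb d → ℝ} (hf : ContDiff ℝ ∞ f) (h1 : Continuous f)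
    (h2 : Continuous (sphGrad f)) : (sphLp f h1, sphLp (sphGrad f) h2) ∈ H1 d := by
  refine ⟨?_, fun X hX ht => ?_⟩
  · filter_upwards [coeFn_sphLp (sphGrad f) h2] with x hx
    rw [hx]
    exact inner_sphGrad_self f (norm_coe_sph x)
  · have h := integral_mul_sphDiv hf hX.1 ht
      ((closure_mono (Function.support_smul_subset_right f X)).trans hX.2)
    have e1 : ∫ x, sphLp f h1 x * sphDiv X x ∂(hemiMeas d) =
        ∫ x, f x * sphDiv X x ∂(hemiMeas d) := by
      refine integral_congr_ae ?_
      filter_upwards [coeFn_sphLp f h1] with x hx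
      rw [hx]
    have e2 : ∫ x, inner ℝ (sphLp (sphGrad f) h2 x) (X x) ∂(hemiMeas d) =
        ∫ x, inner ℝ (sphGrad f x) (X x) ∂(hemiMeas d) := by
      refine integral_congr_ae ?_
      filter_upwards [coeFn_sphLp (sphGrad f) h2] with x hx
      rw [hx]
    exact e1.trans (h.trans (by rw [e2]))

/-! #### Cutoff functions -/

/-- A smooth function of the last coordinate, which vanishes for `x_{d+1} ≤ 1/n` and equals one for
`x_{d+1} ≥ 2/n`. -/
def cutoff (d n : ℕ) (x : Amb d) : ℝ := Real.smoothTransition (n * x (Fin.last d) - 1)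

/-- The function `t ↦ t ∂_t (cutoff)`. -/
def cutoffSlope (n : ℕ) (t : ℝ) : ℝ := deriv Real.smoothTransition (n * t - 1) * (n * t)

theorem contDiff_cutoff (d n : ℕ) : ContDiff ℝ ∞ (cutoff d n) := by
  have h : ContDiff ℝ ∞ (fun x : Amb d => (n : ℝ) * x (Fin.last d) - 1) := by fun_prop
  exact (Real.smoothTransition.contDiff (n := ⊤)).comp h

theorem tsupport_cutoff (d n : ℕ) : tsupport (cutoff d n) ⊆ upperHalf d := by
  have hc : IsClosed {x : Amb d | 1 ≤ (n : ℝ) * x (Fin.last d)} :=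
    isClosed_le continuous_const (by fun_prop)
  have h1 : Function.support (cutoff d n) ⊆ {x : Amb d | 1 ≤ (n : ℝ) * x (Fin.last d)} := by
    intro x hx
    by_contra h
    have h' : ¬ 1 ≤ (n : ℝ) * x (Fin.last d) := h
    exact hx (Real.smoothTransition.zero_of_nonpos (by linarith))
  intro x hx
  have h2 : 1 ≤ (n : ℝ) * x (Fin.last d) := closure_minimal h1 hc hx
  have hn : (0 : ℝ) ≤ n := Nat.cast_nonneg n
  show 0 < x (Fin.last d)
  by_contra h
  nlinarith

theorem fderiv_cutoff (d n : ℕ) (x v : Amb d) : fderiv ℝ (cutoff d n) x v =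
    deriv Real.smoothTransition (n * x (Fin.last d) - 1) * (n * v (Fin.last d)) := by
  have h1 : HasDerivAt Real.smoothTransition (deriv Real.smoothTransition
      (n * x (Fin.last d) - 1)) (n * x (Fin.last d) - 1) :=
    (((Real.smoothTransition.contDiff (n := 1)).differentiable
      (by norm_num)) _).hasDerivAt
  have h2 : HasFDerivAt (fun x : Amb d => (n : ℝ) * x (Fin.last d) - 1)
      ((n : ℝ) • (EuclideanSpace.proj (Fin.last d) : Amb d →L[ℝ] ℝ)) x :=
    (((EuclideanSpace.proj (Fin.last d) : Amb d →L[ℝ] ℝ).hasFDerivAt).const_mul (n : ℝ)).sub_const 1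
  have h3 : HasFDerivAt (cutoff d n) _ x := h1.comp_hasFDerivAt x h2
  rw [h3.fderiv]
  simp

theorem abs_cutoff_le (d n : ℕ) (x : Amb d) : |cutoff d n x| ≤ 1 := by
  rw [cutoff, abs_of_nonneg (Real.smoothTransition.nonneg _)]
  exact Real.smoothTransition.le_one _

theorem tendsto_cutoff (d : ℕ) {x : Amb d} (hx : x ∈ upperHalf d) :
    Tendsto (fun n => cutoff d n x) atTop (nhds 1) := by
  have hx' : 0 < x (Fin.last d) := hx
  obtain ⟨N, hN⟩ := exists_nat_ge (2 / x (Fin.last d))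
  refine tendsto_const_nhds.congr' ?_
  filter_upwards [eventually_ge_atTop N] with n hn
  have : (N : ℝ) ≤ n := by exact_mod_cast hn
  rw [div_le_iff₀ hx'] at hN
  exact (Real.smoothTransition.one_of_one_le (by nlinarith)).symm

theorem deriv_smoothTransition_eq_zero {t : ℝ} (ht : 1 < t) :
    deriv Real.smoothTransition t = 0 := by
  have : Real.smoothTransition =ᶠ[nhds t] fun _ => 1 := by
    filter_upwards [lt_mem_nhds ht] with s hs
    exact Real.smoothTransition.one_of_one_le hs.le
  rw [this.deriv_eq, deriv_const]

theorem deriv_smoothTransition_eq_zero_of_neg {t : ℝ} (ht : t < 0) :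
    deriv Real.smoothTransition t = 0 := by
  have : Real.smoothTransition =ᶠ[nhds t] fun _ => 0 := by
    filter_upwards [gt_mem_nhds ht] with s hs
    exact Real.smoothTransition.zero_of_nonpos hs.le
  rw [this.deriv_eq, deriv_const]

/-- In the variable `s = n t - 1` the function is `S'(s)(s+1)`, with `S` the smooth transition; it
is free of `n` and vanishes outside `[0, 1]`. One factor `t` thus compensates the factor `n` in the
gradient of the cutoff, uniformly in `n`. -/
theorem exists_cutoffSlope_bound : ∃ C : ℝ, 0 ≤ C ∧ ∀ (n : ℕ) (t : ℝ), |cutoffSlope n t| ≤ C := by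
  have hc : Continuous (fun s => deriv Real.smoothTransition s * (s + 1)) :=
    ((Real.smoothTransition.contDiff (n := 1)).continuous_deriv le_rfl).mul (by fun_prop)
  obtain ⟨C, hC⟩ := (isCompact_Icc (a := (0 : ℝ)) (b := 1)).exists_bound_of_continuousOn
    hc.continuousOn
  have hC0 : 0 ≤ C := (norm_nonneg _).trans (hC 0 (by simp))
  refine ⟨C, hC0, fun n t => ?_⟩
  have e : cutoffSlope n t = deriv Real.smoothTransition (n * t - 1) * ((n * t - 1) + 1) := by
    rw [cutoffSlope]; ring
  rw [e]
  by_cases h0 : (n : ℝ) * t - 1 < 0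
  · rw [deriv_smoothTransition_eq_zero_of_neg h0]; simpa using hC0
  by_cases h1 : 1 < (n : ℝ) * t - 1
  · rw [deriv_smoothTransition_eq_zero h1]; simpa using hC0
  exact hC _ ⟨by linarith, by linarith⟩

theorem tendsto_cutoffSlope {t : ℝ} (ht : 0 < t) :
    Tendsto (fun n => cutoffSlope n t) atTop (nhds 0) := by
  obtain ⟨N, hN⟩ := exists_nat_gt (2 / t)
  refine tendsto_const_nhds.congr' ?_
  filter_upwards [eventually_ge_atTop N] with n hn
  have : (N : ℝ) ≤ n := by exact_mod_cast hn
  rw [div_lt_iff₀ ht] at hN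
  rw [cutoffSlope, deriv_smoothTransition_eq_zero (by nlinarith), zero_mul]

/-! ### Harmonic polynomials as functions on the hemisphere -/

section PolyFun

open MvPolynomial

variable {d : ℕ}

/-- The function on `ℝ^{d+1}` of a polynomial. -/
def polyFun (p : MvPolynomial (Fin (d + 1)) ℝ) (x : Amb d) : ℝ := MvPolynomial.eval (fun i => x i) p

/-- The vector field on `ℝ^{d+1}` with polynomial components. -/
def polyField (P : Fin (d + 1) → MvPolynomial (Fin (d + 1)) ℝ) (x : Amb d) : Amb d :=
  WithLp.toLp 2 fun i => polyFun (P i) x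

theorem contDiff_polyFun (p : MvPolynomial (Fin (d + 1)) ℝ) : ContDiff ℝ ∞ (polyFun p) := by
  unfold polyFun
  induction p using MvPolynomial.induction_on with
  | C a => simpa using contDiff_const
  | add p q hp hq => simpa using hp.add hq
  | mul_X p i hp =>
    have : ContDiff ℝ ∞ fun x : Amb d => x i := by fun_prop
    simpa using hp.mul this

theorem continuous_polyFun (p : MvPolynomial (Fin (d + 1)) ℝ) : Continuous (polyFun p) :=
  (contDiff_polyFun p).continuous

theorem contDiff_polyField (P : Fin (d + 1) → MvPolynomial (Fin (d + 1)) ℝ) :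
    ContDiff ℝ ∞ (polyField P) :=
  contDiff_euclidean.mpr fun i => contDiff_polyFun (P i)

theorem fderiv_polyFun (p : MvPolynomial (Fin (d + 1)) ℝ) (x v : Amb d) :
    fderiv ℝ (polyFun p) x v = ∑ i, polyFun (pderiv i p) x * v i := by
  induction p using MvPolynomial.induction_on with
  | C a =>
    have : polyFun (C a) = fun _ : Amb d => a := by funext y; simp [polyFun]
    rw [this]
    simp [polyFun]
  | add p q hp hq =>
    have : polyFun (p + q) = polyFun p + polyFun q := by funext y; simp [polyFun]
    rw [this, fderiv_add ((contDiff_polyFun p).differentiable (by simp) x)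
      ((contDiff_polyFun q).differentiable (by simp) x), add_apply, hp, hq,
      ← Finset.sum_add_distrib]
    refine Finset.sum_congr rfl fun i _ => ?_
    simp [polyFun, add_mul]
  | mul_X p j hp =>
    have e : polyFun (p * X j) = fun y : Amb d => polyFun p y * y j := by funext y; simp [polyFun]
    have h1 := ((contDiff_polyFun p).differentiable (by simp) x).hasFDerivAt
    have h2 : HasFDerivAt (fun y : Amb d => y j) (EuclideanSpace.proj j : Amb d →L[ℝ] ℝ) x :=
      (EuclideanSpace.proj j : Amb d →L[ℝ] ℝ).hasFDerivAt
    rw [e, (h1.fun_mul h2).fderiv]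
    have h3 : ∀ i, polyFun (pderiv i (p * X j)) x * v i =
        polyFun (pderiv i p) x * v i * x j + (if i = j then polyFun p x * v j else 0) := by
      intro i
      rw [pderiv_mul, pderiv_X]
      by_cases hij : i = j
      · subst hij; simp [polyFun]; ring
      · simp [polyFun, hij, Ne.symm hij]; ring
    simp_rw [h3]
    rw [Finset.sum_add_distrib, ← Finset.sum_mul, ← hp]
    simp
    ring

theorem gradient_polyFun (p : MvPolynomial (Fin (d + 1)) ℝ) (x : Amb d) :
    gradient (polyFun p) x = polyField (fun i => pderiv i p) x := by
  refine ext_inner_right ℝ fun v => ?_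
  rw [inner_gradient_left, fderiv_polyFun, PiLp.inner_apply]
  refine Finset.sum_congr rfl fun i _ => ?_
  simp [polyField, mul_comm]

theorem fderiv_polyField_apply (P : Fin (d + 1) → MvPolynomial (Fin (d + 1)) ℝ) (x v : Amb d)
    (i : Fin (d + 1)) : fderiv ℝ (polyField P) x v i = ∑ j, polyFun (pderiv j (P i)) x * v j := by
  have h := ((contDiff_polyField P).differentiable (by simp) x).hasFDerivAt
  have h2 := ((EuclideanSpace.proj i : Amb d →L[ℝ] ℝ).hasFDerivAt).comp x h
  have h3 : fderiv ℝ (polyFun (P i)) x = (EuclideanSpace.proj i : Amb d →L[ℝ] ℝ).comp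
    (fderiv ℝ (polyField P) x) := h2.fderiv
  rw [← fderiv_polyFun, h3]
  rfl

theorem sphDiv_polyField (P : Fin (d + 1) → MvPolynomial (Fin (d + 1)) ℝ) (x : Amb d) :
    sphDiv (polyField P) x = ∑ i, polyFun (pderiv i (P i)) x -
      ∑ i, ∑ j, x i * x j * polyFun (pderiv j (P i)) x := by
  rw [sphDiv, LinearMap.trace_eq_sum_inner _ (EuclideanSpace.basisFun (Fin (d + 1)) ℝ)]
  congr 1
  · refine Finset.sum_congr rfl fun i _ => ?_
    rw [EuclideanSpace.basisFun_apply, EuclideanSpace.inner_single_left]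
    simp only [map_one, one_mul, ContinuousLinearMap.coe_coe]
    rw [fderiv_polyField_apply]
    simp
  · rw [PiLp.inner_apply]
    refine Finset.sum_congr rfl fun i _ => ?_
    rw [fderiv_polyField_apply]
    simp only [RCLike.inner_apply, conj_trivial]
    rw [Finset.mul_sum]
    exact Finset.sum_congr rfl fun j _ => by ring

/-- The field `∇p - k p x`, which on the sphere is the gradient of `p` if `p` is homogeneous of
degree `k`. -/
def tanField (k : ℕ) (p : MvPolynomial (Fin (d + 1)) ℝ) : Amb d → Amb d :=
  polyField fun i => pderiv i p - C (k : ℝ) * (X i * p)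

theorem sum_sq_coord {x : Amb d} (hx : ‖x‖ = 1) : ∑ i, x i * x i = 1 := by
  have h := EuclideanSpace.norm_sq_eq x
  rw [hx] at h
  simpa [pow_two] using h.symm

theorem euler_polyFun {k : ℕ} {p : MvPolynomial (Fin (d + 1)) ℝ} (hp : p.IsHomogeneous k)
    (x : Amb d) : ∑ i, x i * polyFun (pderiv i p) x = k * polyFun p x := by
  have h := congrArg (MvPolynomial.eval fun i => x i) hp.sum_X_mul_pderiv
  simpa [polyFun] using h

theorem inner_tanField {k : ℕ} {p : MvPolynomial (Fin (d + 1)) ℝ} (hp : p.IsHomogeneous k)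
    {x : Amb d} (hx : ‖x‖ = 1) : inner ℝ (tanField k p x) x = 0 := by
  have h1 : inner ℝ (tanField k p x) x =
      ∑ i, x i * polyFun (pderiv i p) x - k * polyFun p x * ∑ i, x i * x i := by
    rw [PiLp.inner_apply, Finset.mul_sum, ← Finset.sum_sub_distrib]
    refine Finset.sum_congr rfl fun i _ => ?_
    simp [tanField, polyField, polyFun]
    ring
  rw [h1, euler_polyFun hp, sum_sq_coord hx]
  ring

theorem sphGrad_polyFun {k : ℕ} {p : MvPolynomial (Fin (d + 1)) ℝ} (hp : p.IsHomogeneous k)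
    (x : Amb d) : sphGrad (polyFun p) x = tanField k p x := by
  have h1 : inner ℝ x (gradient (polyFun p) x) = k * polyFun p x := by
    rw [gradient_polyFun, PiLp.inner_apply, ← euler_polyFun hp]
    refine Finset.sum_congr rfl fun i _ => ?_
    simp [polyField, mul_comm]
  rw [sphGrad, h1, gradient_polyFun]
  ext i
  simp [tanField, polyField, polyFun]
  ring

/-- The eigenvalue equation. The radial correction in `sphDiv` is found by applying the Euler
operator to `∑ X i P i = k p - k|x|² p`; this vanishes on the sphere, but its two terms have degrees
`k` and `k + 2`, so the result there is `-2 k p`. -/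
theorem sphDiv_tanField {k : ℕ} {p : MvPolynomial (Fin (d + 1)) ℝ} (hp : p.IsHomogeneous k)
    (h0 : polyLap p = 0) {x : Amb d} (hx : ‖x‖ = 1) :
    sphDiv (tanField k p) x = -(k * (k + d - 1) * polyFun p x) := by
  set P : Fin (d + 1) → MvPolynomial (Fin (d + 1)) ℝ :=
    fun i => pderiv i p - C (k : ℝ) * (X i * p) with hP
  have hNp : (polyNormSq * p).IsHomogeneous (2 + k) := polyNormSq_isHomogeneous.mul hp
  have hN1 : polyFun (polyNormSq * p) x = polyFun p x := by
    have := sum_sq_coord hx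
    simp only [polyFun, polyNormSq, map_mul, map_sum, eval_X, pow_two, this, one_mul]
  have hq : ∑ i, X i * P i = C (k : ℝ) * p - C (k : ℝ) * (polyNormSq * p) := by
    have h1 : ∀ i, X i * P i = X i * pderiv i p - C (k : ℝ) * (X i ^ 2 * p) := by
      intro i; rw [hP]; ring
    simp_rw [h1]
    rw [Finset.sum_sub_distrib, hp.sum_X_mul_pderiv, ← Finset.mul_sum, ← Finset.sum_mul]
    simp [polyNormSq]
  -- the Euler operator applied to `∑ X i P i`
  have h2 : ∑ j, x j * polyFun (pderiv j (∑ i, X i * P i)) x =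
      k * (k * polyFun p x) - k * ((2 + k) * polyFun p x) := by
    rw [hq]
    have h3 : ∀ j, x j * polyFun (pderiv j (C (k : ℝ) * p - C (k : ℝ) * (polyNormSq * p))) x =
        k * (x j * polyFun (pderiv j p) x) - k * (x j * polyFun (pderiv j (polyNormSq * p)) x) := by
      intro j
      rw [map_sub, pderiv_C_mul, pderiv_C_mul]
      simp only [polyFun, map_sub, map_mul, eval_C]
      ring
    simp_rw [h3]
    rw [Finset.sum_sub_distrib, ← Finset.mul_sum, ← Finset.mul_sum, euler_polyFun hp,
      euler_polyFun hNp, hN1]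
    push_cast
    ring
  have h4 : ∑ j, x j * polyFun (pderiv j (∑ i, X i * P i)) x =
      ∑ i, x i * polyFun (P i) x + ∑ i, ∑ j, x i * x j * polyFun (pderiv j (P i)) x := by
    have h5 : ∀ j, x j * polyFun (pderiv j (∑ i, X i * P i)) x =
        x j * polyFun (P j) x + ∑ i, x i * x j * polyFun (pderiv j (P i)) x := by
      intro j
      rw [map_sum]
      have h6 : ∀ i, pderiv j (X i * P i) = (if i = j then P j else 0) + X i * pderiv j (P i) := by
        intro i
        rw [pderiv_mul, pderiv_X]
        by_cases hij : i = j
        · subst hij; simp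
        · simp [hij]
      simp_rw [h6]
      rw [Finset.sum_add_distrib, Finset.sum_ite_eq' Finset.univ j, if_pos (Finset.mem_univ j)]
      simp only [polyFun, map_add, map_sum, map_mul, eval_X]
      rw [mul_add, Finset.mul_sum]
      congr 1
      exact Finset.sum_congr rfl fun i _ => by ring
    simp_rw [h5]
    rw [Finset.sum_add_distrib]
    congr 1
    exact Finset.sum_comm
  have h7 : ∑ i, x i * polyFun (P i) x = 0 := by
    have := congrArg (MvPolynomial.eval fun i => x i) hq
    simp only [map_sum, map_mul, eval_X, map_sub, eval_C] at this
    have e : MvPolynomial.eval (fun i => x i) (polyNormSq * p) = polyFun p x := hN1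
    rw [map_mul] at e
    show ∑ i, x i * MvPolynomial.eval (fun i => x i) (P i) = 0
    rw [this, e, polyFun, sub_self]
  have h8 : ∑ i, polyFun (pderiv i (P i)) x = -(k * ((d + 1) * polyFun p x + k * polyFun p x)) := by
    have h9 : ∀ i, polyFun (pderiv i (P i)) x = polyFun (pderiv i (pderiv i p)) x -
        k * (polyFun p x + x i * polyFun (pderiv i p) x) := by
      intro i
      rw [hP]
      simp only [map_sub, pderiv_mul, pderiv_X_self]
      simp [polyFun]
    simp_rw [h9]
    rw [Finset.sum_sub_distrib, ← Finset.mul_sum, Finset.sum_add_distrib, euler_polyFun hp]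
    have h10 : ∑ i, polyFun (pderiv i (pderiv i p)) x = 0 := by
      rw [polyLap_apply] at h0
      have := congrArg (MvPolynomial.eval fun i => x i) h0
      simpa [polyFun] using this
    rw [h10, Finset.sum_const, Finset.card_univ, Fintype.card_fin]
    simp
  rw [tanField, sphDiv_polyField, h8]
  rw [h4, h7, zero_add] at h2
  rw [h2]
  ring

end PolyFun

/-! ### Harmonic polynomials are eigenfunctions -/

section Eigen

open MvPolynomial

variable {d : ℕ}

theorem contDiff_tanField (k : ℕ) (p : MvPolynomial (Fin (d + 1)) ℝ) :
    ContDiff ℝ ∞ (tanField k p) := contDiff_polyField _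

theorem continuous_tanField (k : ℕ) (p : MvPolynomial (Fin (d + 1)) ℝ) :
    Continuous (tanField k p) := (contDiff_tanField k p).continuous

theorem sphLp_polyFun_mem_H1 {k : ℕ} {p : MvPolynomial (Fin (d + 1)) ℝ} (hp : p.IsHomogeneous k) :
    (sphLp (polyFun p) (continuous_polyFun p), sphLp (tanField k p) (continuous_tanField k p)) ∈
      H1 d := by
  have h : ∀ (g : Amb d → Amb d) (hg : Continuous g), sphGrad (polyFun p) = g →
      (sphLp (polyFun p) (continuous_polyFun p), sphLp g hg) ∈ H1 d := by
    rintro _ hg rfl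
    exact sphLp_mem_H1 (contDiff_polyFun p) _ _
  exact h _ _ (funext fun x => sphGrad_polyFun hp x)

theorem tendsto_integral_mul_of_bound {u : Sph d → ℝ} (hu : Integrable u (hemiMeas d))
    {w : ℕ → Amb d → ℝ} (hw : ∀ n, Continuous (w n)) {v : Amb d → ℝ} {K : ℝ}
    (hK : ∀ n, ∀ x : Sph d, |w n x| ≤ K)
    (hlim : ∀ x : Sph d, (x : Amb d) ∈ upperHalf d → Tendsto (fun n => w n x) atTop (nhds (v x))) :
    Tendsto (fun n => ∫ x, u x * w n x ∂(hemiMeas d)) atTop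
      (nhds (∫ x, u x * v x ∂(hemiMeas d))) := by
  refine tendsto_integral_of_dominated_convergence (fun x => ‖u x‖ * K) (fun n => ?_)
    (hu.norm.mul_const K) (fun n => ?_) ?_
  · exact hu.aestronglyMeasurable.mul ((hw n).comp continuous_subtype_val).aestronglyMeasurable
  · refine Eventually.of_forall fun x => ?_
    rw [norm_mul]
    exact mul_le_mul_of_nonneg_left (hK n x) (norm_nonneg _)
  · filter_upwards [ae_mem_upperHalf d] with x hx
    exact (hlim x hx).const_mul _

/-- For even `p` the last component of the gradient field is `x_L` times a polynomial, so the
gradient of the cutoff enters only through the bounded `cutoffSlope`. -/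
theorem sphDiv_cutoff_tanField {k : ℕ} {p q : MvPolynomial (Fin (d + 1)) ℝ}
    (hp : p ∈ parityHarmonic (Fin.last d) 0 k) (hq : pderiv (Fin.last d) p = X (Fin.last d) * q)
    (n : ℕ) (x : Sph d) :
    sphDiv (fun y => cutoff d n y • tanField k p y) x =
      cutoff d n x * -(k * (k + d - 1) * polyFun p x) +
        cutoffSlope n ((x : Amb d) (Fin.last d)) * (polyFun q x - k * polyFun p x) := by
  have hhom := parityPoly_isHomogeneous hp.1
  rw [sphDiv_smul ((contDiff_cutoff d n).differentiable (by simp) _)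
    ((contDiff_tanField k p).differentiable (by simp) _) (inner_tanField hhom (norm_coe_sph x)),
    sphDiv_tanField hhom hp.2 (norm_coe_sph x), fderiv_cutoff]
  congr 1
  have : tanField k p (x : Amb d) (Fin.last d) =
      (x : Amb d) (Fin.last d) * (polyFun q x - k * polyFun p x) := by
    simp [tanField, polyField, polyFun, hq]
    ring
  rw [this, cutoffSlope]
  ring

/-- An arbitrary `(u, g)` in `H1` can be paired only with compactly supported fields. It is paired
with `cutoff · ∇p`, and dominated convergence removes the cutoff; the extra term tends to zero
because of the Neumann condition. -/
theorem evenHarmonic_mem_eigenspace {k : ℕ} {p : MvPolynomial (Fin (d + 1)) ℝ}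
    (hp : p ∈ parityHarmonic (Fin.last d) 0 k) :
    sphLp (polyFun p) (continuous_polyFun p) ∈ eigenspace (H1 d) (k * (k + d - 1)) := by
  have hhom := parityPoly_isHomogeneous hp.1
  refine ⟨_, sphLp_polyFun_mem_H1 hhom, ?_⟩
  rintro ⟨u, g⟩ ⟨hg1, hg2⟩
  obtain ⟨q, hq⟩ := X_dvd_pderiv_of_even hp.1
  have hw : ∀ n x, sphDiv (fun y => cutoff d n y • tanField k p y) (x : Sph d) = _ :=
    fun n x => sphDiv_cutoff_tanField hp hq n x
  have htest : ∀ n, IsTest (fun y => cutoff d n y • tanField k p y) := fun n =>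
    ⟨(contDiff_cutoff d n).smul (contDiff_tanField k p),
      (tsupport_smul_subset_left _ _).trans (tsupport_cutoff d n)⟩
  have heq : ∀ n, ∫ x, u x * sphDiv (fun y => cutoff d n y • tanField k p y) x ∂(hemiMeas d) =
      - ∫ x, inner ℝ (g x) (tanField k p x) * cutoff d n x ∂(hemiMeas d) := by
    intro n
    rw [hg2 _ (htest n) fun x => by
      rw [real_inner_smul_left, inner_tanField hhom (norm_coe_sph x), mul_zero]]
    congr 1
    refine integral_congr_ae (Eventually.of_forall fun x => ?_)
    simp only [real_inner_smul_right]
    ring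
  obtain ⟨C, hC0, hC⟩ := exists_cutoffSlope_bound
  obtain ⟨C1, hC1⟩ := continuousOn_sph_bound (d := d)
    (f := fun x => -(k * (k + d - 1) * polyFun p x))
    ((continuous_polyFun p).const_smul (k * (k + d - 1) : ℝ)).neg
  obtain ⟨C2, hC2⟩ := continuousOn_sph_bound (d := d) (f := fun x => polyFun q x - k * polyFun p x)
    ((continuous_polyFun q).sub ((continuous_polyFun p).const_smul (k : ℝ)))
  have hu : Integrable (fun x => u x) (hemiMeas d) := (Lp.memLp u).integrable (by norm_num)
  have l1 := tendsto_integral_mul_of_bound (d := d) hu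
    (w := fun n => sphDiv (fun y => cutoff d n y • tanField k p y))
    (v := fun x => -(k * (k + d - 1) * polyFun p x)) (K := C1 + C * C2)
    (fun n => continuous_sphDiv ((htest n).1.of_le (by exact_mod_cast le_top)))
    (fun n x => by
      rw [hw]
      refine (abs_add_le _ _).trans ?_
      rw [abs_mul, abs_mul]
      have h1 := hC1 x
      have h2 := hC2 x
      rw [Real.norm_eq_abs] at h1 h2
      refine add_le_add ?_ (mul_le_mul (hC _ _) h2 (abs_nonneg _) hC0)
      calc _ ≤ 1 * C1 := mul_le_mul (abs_cutoff_le d n x) h1 (abs_nonneg _) zero_le_one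
        _ = C1 := one_mul _)
    (fun x hx => by
      simp_rw [hw]
      have := ((tendsto_cutoff d hx).mul_const (-(k * (k + d - 1) * polyFun p x))).add
        ((tendsto_cutoffSlope hx).mul_const (polyFun q x - k * polyFun p x))
      simpa using this)
  have hgi : Integrable (fun x => inner ℝ (g x) (tanField k p x)) (hemiMeas d) := by
    refine (L2.integrable_inner (𝕜 := ℝ) g
      (sphLp (tanField k p) (continuous_tanField k p))).congr ?_
    filter_upwards [coeFn_sphLp (tanField k p) (continuous_tanField k p)] with x hx
    rw [hx]
  have l2 := tendsto_integral_mul_of_bound (d := d) hgi (w := fun n => cutoff d n)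
    (v := fun _ => 1) (K := 1) (fun n => (contDiff_cutoff d n).continuous)
    (fun n x => abs_cutoff_le d n x) (fun x hx => tendsto_cutoff d hx)
  simp_rw [heq] at l1
  have h := tendsto_nhds_unique l1 l2.neg
  rw [inner_sphLp_left, inner_sphLp_left, ← integral_const_mul]
  have e1 : ∫ x, inner ℝ (tanField k p x) (g x) ∂(hemiMeas d) =
      ∫ x, inner ℝ (g x) (tanField k p x) * 1 ∂(hemiMeas d) :=
    integral_congr_ae (Eventually.of_forall fun x => by
      show inner ℝ (tanField k p x) (g x) = inner ℝ (g x) (tanField k p x) * 1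
      rw [mul_one, real_inner_comm])
  refine e1.trans ?_
  rw [← neg_inj, ← h, ← integral_neg]
  refine integral_congr_ae (Eventually.of_forall fun x => ?_)
  simp only [RCLike.inner_apply, conj_trivial]
  ring

theorem sphGrad_cutoff_mul {k : ℕ} {p q : MvPolynomial (Fin (d + 1)) ℝ} (hp : p.IsHomogeneous k)
    (hq : p = X (Fin.last d) * q) (n : ℕ) (x : Amb d) :
    sphGrad (fun y => cutoff d n y * polyFun p y) x = cutoff d n x • tanField k p x +
      (cutoffSlope n (x (Fin.last d)) * polyFun q x) •
        (EuclideanSpace.single (Fin.last d) 1 - x (Fin.last d) • x) := by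
  have h1 := ((contDiff_cutoff d n).differentiable (by simp) x).hasFDerivAt
  have h2 := ((contDiff_polyFun p).differentiable (by simp) x).hasFDerivAt
  have h3 : fderiv ℝ (fun y => cutoff d n y * polyFun p y) x = _ := (h1.fun_mul h2).fderiv
  have hpx : polyFun p x = x (Fin.last d) * polyFun q x := by rw [hq]; simp [polyFun]
  have h4 : gradient (fun y => cutoff d n y * polyFun p y) x =
      cutoff d n x • gradient (polyFun p) x +
        (cutoffSlope n (x (Fin.last d)) * polyFun q x) • EuclideanSpace.single (Fin.last d) 1 := by
    refine ext_inner_right ℝ fun v => ?_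
    rw [inner_gradient_left, h3, inner_add_left, real_inner_smul_left, inner_gradient_left,
      real_inner_smul_left, EuclideanSpace.inner_single_left]
    simp only [add_apply, smul_apply, smul_eq_mul, map_one, one_mul]
    rw [fderiv_cutoff, hpx, cutoffSlope]
    ring
  rw [← sphGrad_polyFun hp, sphGrad, sphGrad, h4, inner_add_right, real_inner_smul_right,
    real_inner_smul_right, EuclideanSpace.inner_single_right]
  simp only [one_mul, conj_trivial, smul_sub, add_smul, smul_smul]
  abel

/-- The test functions `cutoff · p` converge to `p` in the `H¹` norm: writing `p = x_L q`, the error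
in the gradient is `cutoffSlope` times a bounded field, so it is bounded and tends to zero
pointwise. -/
theorem sphLp_polyFun_mem_H10 {k : ℕ} {p : MvPolynomial (Fin (d + 1)) ℝ}
    (hp : p ∈ parityHarmonic (Fin.last d) 1 k) :
    (sphLp (polyFun p) (continuous_polyFun p), sphLp (tanField k p) (continuous_tanField k p)) ∈
      H10 d := by
  have hhom := parityPoly_isHomogeneous hp.1
  obtain ⟨q, hq⟩ := X_dvd_of_odd hp.1
  set f : ℕ → Amb d → ℝ := fun n y => cutoff d n y * polyFun p y with hf
  have hfs : ∀ n, ContDiff ℝ ∞ (f n) := fun n => (contDiff_cutoff d n).mul (contDiff_polyFun p)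
  have hf1 : ∀ n, ContDiff ℝ 1 (f n) := fun n => (hfs n).of_le (by exact_mod_cast le_top)
  obtain ⟨C, hC0, hC⟩ := exists_cutoffSlope_bound
  obtain ⟨C1, hC1⟩ := continuousOn_sph_bound (continuous_polyFun p)
  obtain ⟨C2, hC2⟩ := continuousOn_sph_bound (continuous_tanField k p)
  obtain ⟨C3, hC3⟩ := continuousOn_sph_bound (d := d)
    (f := fun x => polyFun q x • (EuclideanSpace.single (Fin.last d) 1 - x (Fin.last d) • x))
    (by have := continuous_polyFun q; fun_prop)
  have hg : ∀ n x, sphGrad (f n) x = _ := fun n x => sphGrad_cutoff_mul hhom hq n x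
  have l1 : Tendsto (fun n => sphLp (f n) (hf1 n).continuous) atTop
      (nhds (sphLp (polyFun p) (continuous_polyFun p))) := by
    refine tendsto_sphLp _ _ (C := C1) (fun n x _ => ?_) fun x hx => ?_
    · rw [hf, norm_mul]
      calc _ ≤ 1 * C1 := mul_le_mul (abs_cutoff_le d n x) (hC1 x) (norm_nonneg _) zero_le_one
        _ = C1 := one_mul _
    · simpa using (tendsto_cutoff d hx).mul_const (polyFun p x)
  have l2 : Tendsto (fun n => sphLp (sphGrad (f n)) (continuous_sphGrad (hf1 n))) atTop
      (nhds (sphLp (tanField k p) (continuous_tanField k p))) := by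
    refine tendsto_sphLp _ _ (C := C2 + C * C3) (fun n x _ => ?_) fun x hx => ?_
    · rw [hg, mul_smul]
      refine (norm_add_le _ _).trans ?_
      rw [norm_smul, norm_smul]
      refine add_le_add ?_ (mul_le_mul (hC _ _) (hC3 x) (norm_nonneg _) hC0)
      calc _ ≤ 1 * C2 := mul_le_mul (abs_cutoff_le d n x) (hC2 x) (norm_nonneg _) zero_le_one
        _ = C2 := one_mul _
    · simp_rw [hg, mul_smul]
      have := ((tendsto_cutoff d hx).smul_const (tanField k p (x : Amb d))).add
        ((tendsto_cutoffSlope hx).smul_const (polyFun q x •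
          (EuclideanSpace.single (Fin.last d) 1 - (x : Amb d) (Fin.last d) • (x : Amb d))))
      simpa using this
  refine mem_closure_of_tendsto (l1.prodMk_nhds l2) (Eventually.of_forall fun n => ?_)
  refine Submodule.subset_span ⟨f n, ⟨hfs n, ?_⟩, coeFn_sphLp _ (hf1 n).continuous,
    coeFn_sphLp _ (continuous_sphGrad (hf1 n))⟩
  exact (tsupport_mul_subset_left).trans (tsupport_cutoff d n)

theorem oddHarmonic_mem_eigenspace {k : ℕ} {p : MvPolynomial (Fin (d + 1)) ℝ}
    (hp : p ∈ parityHarmonic (Fin.last d) 1 k) :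
    sphLp (polyFun p) (continuous_polyFun p) ∈ eigenspace (H10 d) (k * (k + d - 1)) := by
  have hhom := parityPoly_isHomogeneous hp.1
  refine ⟨_, sphLp_polyFun_mem_H10 hp, ?_⟩
  set u := sphLp (polyFun p) (continuous_polyFun p)
  set g := sphLp (tanField k p) (continuous_tanField k p)
  -- The weak equation says that `T` vanishes. As `ker T` is a closed subspace, it is enough to
  -- check test pairs, by integration by parts.
  let T : L2Fun d × L2Vec d →L[ℝ] ℝ := (innerSL ℝ g).comp (ContinuousLinearMap.snd ℝ _ _) -
    (k * (k + d - 1) : ℝ) • (innerSL ℝ u).comp (ContinuousLinearMap.fst ℝ _ _)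
  have hT : ∀ a, T a = inner ℝ g a.2 - k * (k + d - 1) * inner ℝ u a.1 := fun a => rfl
  suffices h : H10 d ≤ LinearMap.ker (T : L2Fun d × L2Vec d →ₗ[ℝ] ℝ) by
    intro a ha
    have h1 : T a = 0 := h ha
    rw [hT] at h1
    linarith
  refine Submodule.topologicalClosure_minimal _ ?_ (T.isClosed_ker)
  rw [Submodule.span_le]
  rintro ⟨v, w⟩ ⟨φ, hφ, hv, hw⟩
  show T (v, w) = 0
  rw [hT, inner_sphLp_left, inner_sphLp_left]
  have h := integral_mul_sphDiv hφ.1 (contDiff_tanField k p)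
    (fun x => inner_tanField hhom (norm_coe_sph x))
    ((tsupport_smul_subset_left φ (tanField k p)).trans hφ.2)
  have e1 : ∫ x, inner ℝ (tanField k p x) (w x) ∂(hemiMeas d) =
      ∫ x, inner ℝ (sphGrad φ x) (tanField k p x) ∂(hemiMeas d) := by
    refine integral_congr_ae ?_
    filter_upwards [hw] with x hx
    rw [hx, real_inner_comm]
  have e2 : ∫ x, φ x * sphDiv (tanField k p) x ∂(hemiMeas d) =
      -(k * (k + d - 1) * ∫ x, inner ℝ (polyFun p x) (v x) ∂(hemiMeas d)) := by
    rw [← integral_const_mul, ← integral_neg]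
    refine integral_congr_ae ?_
    filter_upwards [hv] with x hx
    rw [sphDiv_tanField hhom hp.2 (norm_coe_sph x), hx]
    simp only [RCLike.inner_apply, conj_trivial]
    ring
  show (∫ x, inner ℝ (tanField k p x) (w x) ∂(hemiMeas d)) -
    k * (k + d - 1) * ∫ x, inner ℝ (polyFun p x) (v x) ∂(hemiMeas d) = 0
  linarith

end Eigen

/-! ### Completeness of the harmonic polynomials and the eigenspaces -/

/-- If the finite dimensional spaces `E k` consist of eigenvectors for distinct numbers `l k` and
only zero is orthogonal to all of them, then they are exactly the eigenspaces. -/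
theorem eigenspace_eq_of_total {d : ℕ} (V : Submodule ℝ (L2Fun d × L2Vec d)) (l : ℕ → ℝ)
    (E : ℕ → Submodule ℝ (L2Fun d)) [∀ k, FiniteDimensional ℝ (E k)]
    (hE : ∀ k, E k ≤ eigenspace V (l k))
    (htot : ∀ u : L2Fun d, (∀ k, ∀ v ∈ E k, inner ℝ u v = 0) → u = 0) :
    (Function.Injective l → ∀ k, eigenspace V (l k) = E k) ∧
      ∀ t, t ∉ Set.range l → eigenspace V t = ⊥ := by
  -- Each eigenvector is tested against the other; the energy form is symmetric.
  have orth : ∀ s t : ℝ, s ≠ t → ∀ u ∈ eigenspace V s, ∀ v ∈ eigenspace V t, inner ℝ u v = 0 := by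
    rintro s t hst u ⟨g, hg, hu⟩ v ⟨h, hh, hv⟩
    have h1 := hu _ hh
    have h2 := hv _ hg
    simp only at h1 h2
    rw [real_inner_comm g h, real_inner_comm u v, h1] at h2
    have h3 : (s - t) * inner ℝ u v = 0 := by linarith
    exact (mul_eq_zero.mp h3).resolve_left (sub_ne_zero.mpr hst)
  constructor
  · intro hl k
    refine le_antisymm (fun u hu => ?_) (hE k)
    have hP := (E k).starProjection_apply_mem u
    -- The remainder is orthogonal to `E k` by projection, and to every other `E j` because it is
    -- still an eigenvector for `l k`.
    have hw : u - (E k).starProjection u = 0 := by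
      refine htot _ fun j v hv => ?_
      by_cases hjk : j = k
      · subst hjk
        exact Submodule.starProjection_inner_eq_zero u v hv
      · exact orth _ _ (hl.ne (Ne.symm hjk)) _ ((eigenspace V (l k)).sub_mem hu (hE k hP)) _ (hE j hv)
    rw [sub_eq_zero] at hw
    rw [hw]
    exact hP
  · intro t ht
    rw [eq_bot_iff]
    intro u hu
    rw [Submodule.mem_bot]
    exact htot u fun k v hv => orth _ _ (fun h => ht ⟨k, h.symm⟩) u hu v (hE k hv)

section Total

open MvPolynomial

variable {d : ℕ}

/-- The linear map from polynomials to `L²(S^d_+)`. -/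
def polyLp (d : ℕ) : MvPolynomial (Fin (d + 1)) ℝ →ₗ[ℝ] L2Fun d where
  toFun p := sphLp (polyFun p) (continuous_polyFun p)
  map_add' p q := by
    simp only [sphLp]
    rw [← map_add]
    congr 1
    ext x
    simp [polyFun]
  map_smul' c p := by
    simp only [sphLp]
    rw [← map_smul]
    congr 1
    ext x
    simp [polyFun, smul_eq_C_mul]

theorem inner_polyLp (u : L2Fun d) (p : MvPolynomial (Fin (d + 1)) ℝ) :
    inner ℝ u (polyLp d p) = ∫ x, u x * polyFun p x ∂(hemiMeas d) := by
  rw [real_inner_comm]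
  refine (inner_sphLp_left (polyFun p) (continuous_polyFun p) u).trans
    (integral_congr_ae (Eventually.of_forall fun x => ?_))
  simp only [RCLike.inner_apply, conj_trivial]

theorem polyFun_smul {k : ℕ} {p : MvPolynomial (Fin (d + 1)) ℝ} (hp : p.IsHomogeneous k) (c : ℝ)
    (x : Amb d) : polyFun p (c • x) = c ^ k * polyFun p x := by
  rw [polyFun, polyFun, eval_eq', eval_eq', Finset.mul_sum]
  refine Finset.sum_congr rfl fun s hs => ?_
  have hk : ∑ i, s i = k := by
    have h := hp (mem_support_iff.mp hs)
    rw [← h, ← Finsupp.degree_eq_sum, Finsupp.degree_eq_weight_one]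
    rfl
  rw [← hk, ← Finset.prod_pow_eq_pow_sum, mul_left_comm, ← Finset.prod_mul_distrib]
  congr 1
  exact Finset.prod_congr rfl fun i _ => by simp [mul_pow]

theorem coeFn_polyLp (p : MvPolynomial (Fin (d + 1)) ℝ) :
    ∀ᵐ x ∂(hemiMeas d), polyLp d p x = polyFun p x :=
  coeFn_sphLp (polyFun p) (continuous_polyFun p)

theorem polyFun_eq_zero_of_polyLp_eq_zero {p : MvPolynomial (Fin (d + 1)) ℝ}
    (h : polyLp d p = 0) {x : Sph d} (hx : x ∈ hemi d) : polyFun p x = 0 := by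
  have hpos : (surf d).IsOpenPosMeasure := by unfold surf; infer_instance
  have hc : Continuous fun x : Sph d => polyFun p x :=
    (continuous_polyFun p).comp continuous_subtype_val
  have hae : (fun x : Sph d => polyFun p x) =ᵐ[(surf d).restrict (hemi d)] fun _ => (0 : ℝ) := by
    have h2 : ∀ᵐ x ∂(hemiMeas d), (0 : L2Fun d) x = 0 := Lp.coeFn_zero ℝ 2 (hemiMeas d)
    have h1 := coeFn_polyLp p
    rw [h] at h1
    filter_upwards [h1, h2] with x hx1 hx2
    exact hx1.symm.trans hx2
  exact Measure.eqOn_open_of_ae_eq hae (isOpen_hemi d) hc.continuousOn continuousOn_const hx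

/-- By homogeneity `p` vanishes on the whole open half-space, which contains a product of infinite
sets. Hence passing to `L²(S^d_+)` preserves dimensions. -/
theorem eq_zero_of_polyLp_eq_zero {k : ℕ} {p : MvPolynomial (Fin (d + 1)) ℝ}
    (hp : p.IsHomogeneous k) (h : polyLp d p = 0) : p = 0 := by
  have key : ∀ x : Amb d, 0 < x (Fin.last d) → polyFun p x = 0 := by
    intro x hlast
    have hx0 : x ≠ 0 := by
      rintro rfl
      simp at hlast
    have hn : 0 < ‖x‖ := norm_pos_iff.mpr hx0
    have hw : (‖x‖⁻¹ • x) ∈ Metric.sphere (0 : Amb d) 1 := by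
      rw [mem_sphere_zero_iff_norm, norm_smul, norm_inv, norm_norm, inv_mul_cancel₀ hn.ne']
    have hwh : (⟨‖x‖⁻¹ • x, hw⟩ : Sph d) ∈ hemi d := by
      show 0 < (‖x‖⁻¹ • x) (Fin.last d)
      rw [PiLp.smul_apply, smul_eq_mul]
      positivity
    have h4 : polyFun p (‖x‖⁻¹ • x) = 0 := polyFun_eq_zero_of_polyLp_eq_zero
      (x := ⟨‖x‖⁻¹ • x, hw⟩) h hwh
    have h5 : x = ‖x‖ • (‖x‖⁻¹ • x) := by rw [smul_smul, mul_inv_cancel₀ hn.ne', one_smul]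
    rw [h5, polyFun_smul hp, h4, mul_zero]
  refine funext_set (s := fun _ => Set.Ioi (0 : ℝ)) (fun _ => Set.Ioi_infinite 0) fun y hy => ?_
  rw [map_zero]
  exact key (WithLp.toLp 2 y) (hy (Fin.last d) (Set.mem_univ _))

/-- Polynomials of parity `e` in the last variable. -/
def parityPolyAll (d e : ℕ) : Submodule ℝ (MvPolynomial (Fin (d + 1)) ℝ) :=
  restrictSupport ℝ {s | s (Fin.last d) % 2 = e}

theorem mul_mem_parityPolyAll {a b : ℕ} {p q : MvPolynomial (Fin (d + 1)) ℝ}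
    (hp : p ∈ parityPolyAll d a) (hq : q ∈ parityPolyAll d b) :
    p * q ∈ parityPolyAll d ((a + b) % 2) := by
  have h := Submodule.mul_mem_mul hp hq
  rw [parityPolyAll, parityPolyAll, ← restrictSupport_add] at h
  refine restrictSupport_mono ℝ ?_ h
  rintro _ ⟨s, hs, t, ht, rfl⟩
  have hs' : s (Fin.last d) % 2 = a := hs
  have ht' : t (Fin.last d) % 2 = b := ht
  show (s + t) (Fin.last d) % 2 = (a + b) % 2
  rw [Finsupp.add_apply]
  omega

/-- The algebra of polynomials which are even in the last variable. -/
def evenPolyAlgebra (d : ℕ) : Subalgebra ℝ (MvPolynomial (Fin (d + 1)) ℝ) where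
  carrier := parityPolyAll d 0
  mul_mem' hp hq := mul_mem_parityPolyAll hp hq
  add_mem' hp hq := Submodule.add_mem _ hp hq
  algebraMap_mem' r := by
    show monomial 0 r ∈ restrictSupport ℝ _
    rw [monomial_mem_restrictSupport]
    left
    simp

/-- The closed hemisphere. -/
abbrev ClosedHemi (d : ℕ) : Type := {x : Sph d // 0 ≤ (x : Amb d) (Fin.last d)}

instance (d : ℕ) : CompactSpace (ClosedHemi d) := by
  have hc : IsClosed {x : Sph d | 0 ≤ (x : Amb d) (Fin.last d)} :=
    isClosed_le continuous_const
      ((by fun_prop : Continuous fun x : Amb d => x (Fin.last d)).comp continuous_subtype_val)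
  exact isCompact_iff_compactSpace.mp hc.isCompact

/-- Restriction of polynomials to the closed hemisphere. -/
def polyRestrict (d : ℕ) : MvPolynomial (Fin (d + 1)) ℝ →ₐ[ℝ] C(ClosedHemi d, ℝ) where
  toFun p := ⟨fun x => polyFun p x.1.1,
    (continuous_polyFun p).comp (continuous_subtype_val.comp continuous_subtype_val)⟩
  map_one' := by ext x; simp [polyFun]
  map_mul' p q := by ext x; simp [polyFun]
  map_zero' := by ext x; simp [polyFun]
  map_add' p q := by ext x; simp [polyFun]
  commutes' r := by ext x; simp [polyFun]

/-- On the closed hemisphere the last coordinate is nonnegative, so its square determines it. -/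
theorem separatesPoints_evenPoly (d : ℕ) :
    ((evenPolyAlgebra d).map (polyRestrict d)).SeparatesPoints := by
  intro x y hxy
  have hmem : ∀ p ∈ evenPolyAlgebra d, polyFun p x.1.1 ≠ polyFun p y.1.1 →
      ∃ f ∈ (fun f : C(ClosedHemi d, ℝ) => (f : ClosedHemi d → ℝ)) ''
        ((evenPolyAlgebra d).map (polyRestrict d) : Set C(ClosedHemi d, ℝ)), f x ≠ f y :=
    fun p hp h => ⟨_, ⟨polyRestrict d p, ⟨p, hp, rfl⟩, rfl⟩, h⟩
  have hne : ∃ i, x.1.1 i ≠ y.1.1 i := by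
    by_contra hcon
    push Not at hcon
    exact hxy (Subtype.ext (Subtype.ext (PiLp.ext hcon)))
  obtain ⟨i, hi⟩ := hne
  by_cases hL : i = Fin.last d
  · subst hL
    refine hmem (X (Fin.last d) ^ 2) ?_ ?_
    · show X (Fin.last d) ^ 2 ∈ parityPolyAll d 0
      rw [X_pow_eq_monomial, parityPolyAll, monomial_mem_restrictSupport]
      left
      simp
    · intro h
      simp only [polyFun, map_pow, eval_X] at h
      exact hi ((sq_eq_sq₀ x.2 y.2).mp h)
  · refine hmem (X i) ?_ (by simpa [polyFun] using hi)
    show X i ∈ parityPolyAll d 0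
    rw [X, parityPolyAll, monomial_mem_restrictSupport]
    left
    simp [hL]

theorem eq_zero_of_integral_mul_even_eq_zero (u : L2Fun d)
    (h : ∀ p ∈ parityPolyAll d 0, ∫ x, u x * polyFun p x ∂(hemiMeas d) = 0) : u = 0 := by
  have hu : Integrable (fun x => u x) (hemiMeas d) := (Lp.memLp u).integrable (by norm_num)
  refine (ContinuousMap.toLp_denseRange (α := Sph d) (E := ℝ) (μ := hemiMeas d) ℝ
    (p := 2) (by norm_num)).eq_zero_of_inner_left ℝ fun f => ?_
  have hin : inner ℝ u (ContinuousMap.toLp 2 (hemiMeas d) ℝ f) = ∫ x, u x * f x ∂(hemiMeas d) := by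
    rw [L2.inner_def]
    refine integral_congr_ae ?_
    filter_upwards [ContinuousMap.coeFn_toLp (p := 2) (hemiMeas d) (𝕜 := ℝ) f] with x hx
    rw [hx]
    simp only [RCLike.inner_apply, conj_trivial]
    ring
  rw [hin]
  have hint : ∀ g : C(Sph d, ℝ), Integrable (fun x => u x * g x) (hemiMeas d) := fun g => by
    obtain ⟨C, hC⟩ := (isCompact_univ (X := Sph d)).exists_bound_of_continuousOn
      g.continuous.continuousOn
    exact hu.mul_bdd (c := C) g.continuous.aestronglyMeasurable
      (Eventually.of_forall fun x => hC x (Set.mem_univ x))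
  have hbound : ∀ ε : ℝ, 0 < ε → |∫ x, u x * f x ∂(hemiMeas d)| ≤
      (∫ x, ‖u x‖ ∂(hemiMeas d)) * ε := by
    intro ε hε
    obtain ⟨⟨_, p, hp, rfl⟩, hg⟩ := ContinuousMap.exists_mem_subalgebra_near_continuous_of_separatesPoints _
      (separatesPoints_evenPoly d) (fun x => f x.1) (f.continuous.comp continuous_subtype_val) ε hε
    have hp' : Integrable (fun x => u x * polyFun p x) (hemiMeas d) := hint ⟨fun x => polyFun p x, (continuous_polyFun p).comp continuous_subtype_val⟩
    have e : ∫ x, u x * f x ∂(hemiMeas d) = ∫ x, (u x * f x - u x * polyFun p x) ∂(hemiMeas d) := by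
      rw [integral_sub (hint f) hp', h p hp, sub_zero]
    rw [e, ← Real.norm_eq_abs, ← integral_mul_const]
    refine norm_integral_le_of_norm_le (hu.norm.mul_const ε) ?_
    filter_upwards [ae_mem_upperHalf d] with x hx
    rw [← mul_sub, norm_mul, norm_sub_rev]
    exact mul_le_mul_of_nonneg_left (hg ⟨x, le_of_lt hx⟩).le (norm_nonneg _)
  have hlim : Tendsto (fun ε : ℝ => (∫ x, ‖u x‖ ∂(hemiMeas d)) * ε) (nhdsWithin 0 (Set.Ioi 0))
      (nhds 0) := by
    have : Tendsto (fun ε : ℝ => (∫ x, ‖u x‖ ∂(hemiMeas d)) * ε) (nhds 0)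
        (nhds ((∫ x, ‖u x‖ ∂(hemiMeas d)) * 0)) := (continuous_const.mul continuous_id).tendsto 0
    rw [mul_zero] at this
    exact this.mono_left nhdsWithin_le_nhds
  have h0 : |∫ x, u x * f x ∂(hemiMeas d)| ≤ 0 :=
    ge_of_tendsto hlim (by filter_upwards [self_mem_nhdsWithin] with ε hε using hbound ε hε)
  exact abs_nonpos_iff.mp h0

/-- The even case applies to `u x_{d+1}`, and `x_{d+1}` is nonzero on the open hemisphere. -/
theorem eq_zero_of_integral_mul_odd_eq_zero (u : L2Fun d)
    (h : ∀ p ∈ parityPolyAll d 1, ∫ x, u x * polyFun p x ∂(hemiMeas d) = 0) : u = 0 := by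
  have hc : Continuous fun x : Sph d => (x : Amb d) (Fin.last d) :=
    (by fun_prop : Continuous fun x : Amb d => x (Fin.last d)).comp continuous_subtype_val
  have hmem : MemLp (fun x : Sph d => u x * (x : Amb d) (Fin.last d)) 2 (hemiMeas d) := by
    refine (Lp.memLp u).of_le ((Lp.aestronglyMeasurable u).mul hc.aestronglyMeasurable)
      (Eventually.of_forall fun x => ?_)
    rw [norm_mul]
    have : ‖(x : Amb d) (Fin.last d)‖ ≤ 1 := by
      have h1 := PiLp.norm_apply_le (x : Amb d) (Fin.last d)
      rwa [norm_coe_sph] at h1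
    exact mul_le_of_le_one_right (norm_nonneg _) this
  have hv : hmem.toLp _ = 0 := by
    refine eq_zero_of_integral_mul_even_eq_zero _ fun p hp => ?_
    have hX : X (Fin.last d) ∈ parityPolyAll d 1 := by
      rw [X, parityPolyAll, monomial_mem_restrictSupport]
      left
      simp
    rw [← h _ (mul_mem_parityPolyAll hX hp)]
    refine integral_congr_ae ?_
    filter_upwards [hmem.coeFn_toLp] with x hx
    rw [hx]
    simp only [polyFun, map_mul, eval_X]
    ring
  have h0 : ∀ᵐ x ∂(hemiMeas d), hmem.toLp _ x = (0 : ℝ) := by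
    rw [hv]; exact Lp.coeFn_zero ℝ 2 (hemiMeas d)
  refine Lp.eq_zero_iff_ae_eq_zero.mpr ?_
  filter_upwards [h0, hmem.coeFn_toLp, ae_mem_upperHalf d] with x h1 h2 h3
  have h3' : 0 < (x : Amb d) (Fin.last d) := h3
  rw [h2] at h1
  exact (mul_eq_zero.mp h1).resolve_right h3'.ne'

/-- The span in `L²(S^d_+)` of the harmonic polynomials of degree `k` and parity `e`. -/
def harmonicSpace (d e k : ℕ) : Submodule ℝ (L2Fun d) :=
  (parityHarmonic (Fin.last d) e k).map (polyLp d)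

instance (e k : ℕ) : FiniteDimensional ℝ (parityHarmonic (Fin.last d) e k) :=
  Submodule.finiteDimensional_of_le (inf_le_left : _ ≤ parityPoly (Fin.last d) e k)

instance (e k : ℕ) : FiniteDimensional ℝ (harmonicSpace d e k) := by
  unfold harmonicSpace; infer_instance

theorem finrank_harmonicSpace (d e k : ℕ) : Module.finrank ℝ (harmonicSpace d e k) =
    Module.finrank ℝ (parityHarmonic (Fin.last d) e k) := by
  have hinj : Function.Injective ((polyLp d).domRestrict (parityHarmonic (Fin.last d) e k)) := by
    rw [← LinearMap.ker_eq_bot, LinearMap.ker_eq_bot']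
    exact fun p hp => Subtype.ext (eq_zero_of_polyLp_eq_zero (parityPoly_isHomogeneous p.2.1) hp)
  rw [harmonicSpace, ← LinearMap.range_domRestrict]
  exact LinearMap.finrank_range_of_inj hinj

theorem polyLp_normSq_mul (q : MvPolynomial (Fin (d + 1)) ℝ) :
    polyLp d (polyNormSq * q) = polyLp d q := by
  show sphLp (polyFun _) (continuous_polyFun _) = sphLp (polyFun _) (continuous_polyFun _)
  simp only [sphLp]
  congr 1
  ext x
  have := sum_sq_coord (norm_coe_sph x)
  simp only [ContinuousMap.coe_mk, polyFun, polyNormSq, map_mul, map_sum, eval_X, pow_two, this,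
    one_mul]

/-- Since `|x|² = 1` on the sphere, every polynomial restricts to a sum of harmonic ones of the same
parity; the induction strips one factor `|x|²` at a time. -/
theorem inner_polyLp_eq_zero {e : ℕ} {u : L2Fun d}
    (h : ∀ k, ∀ v ∈ harmonicSpace d e k, inner ℝ u v = 0) (k : ℕ)
    (p : MvPolynomial (Fin (d + 1)) ℝ) (hp : p ∈ parityPoly (Fin.last d) e k) :
    inner ℝ u (polyLp d p) = 0 := by
  induction k using Nat.strong_induction_on generalizing p with
  | _ k ih =>
    rcases (exists_polyLap_eq_and_decomposition (Fin.last d) e k).2 p hp with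
      hh | ⟨g, hg, i, rfl, q, hq, rfl⟩
    · exact h k _ ⟨p, hh, rfl⟩
    · rw [map_add, inner_add_right, polyLp_normSq_mul, h _ _ ⟨g, hg, rfl⟩, ih i (by omega) q hq,
        add_zero]

theorem integral_mul_parity_eq_zero {e : ℕ} {u : L2Fun d}
    (h : ∀ k, ∀ v ∈ harmonicSpace d e k, inner ℝ u v = 0)
    (p : MvPolynomial (Fin (d + 1)) ℝ) (hp : p ∈ parityPolyAll d e) :
    ∫ x, u x * polyFun p x ∂(hemiMeas d) = 0 := by
  rw [← inner_polyLp]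
  have hle : parityPolyAll d e ≤
      LinearMap.ker ((innerSL ℝ u : L2Fun d →ₗ[ℝ] ℝ) ∘ₗ polyLp d) := by
    rw [parityPolyAll, restrictSupport_eq_span, Submodule.span_le]
    rintro _ ⟨s, hs, rfl⟩
    refine inner_polyLp_eq_zero h s.degree _ ?_
    rw [parityPoly, monomial_mem_restrictSupport]
    exact Or.inl ⟨rfl, hs⟩
  exact hle hp

/-- The eigenvalues. -/
def lam (d k : ℕ) : ℝ := k * (k + d - 1)

theorem lam_strictMono (hd : 2 ≤ d) : StrictMono (lam d) := by
  refine strictMono_nat_of_lt_succ fun k => ?_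
  have h1 : (2 : ℝ) ≤ d := by exact_mod_cast hd
  have h2 : (0 : ℝ) ≤ k := Nat.cast_nonneg k
  simp only [lam]
  push_cast
  nlinarith

theorem harmonicSpace_zero_le (k : ℕ) : harmonicSpace d 0 k ≤ eigenspace (H1 d) (lam d k) := by
  rintro _ ⟨p, hp, rfl⟩
  exact evenHarmonic_mem_eigenspace hp

theorem harmonicSpace_one_le (k : ℕ) : harmonicSpace d 1 k ≤ eigenspace (H10 d) (lam d k) := by
  rintro _ ⟨p, hp, rfl⟩
  exact oddHarmonic_mem_eigenspace hp

theorem multiplicity_of_total (hd : 2 ≤ d) (V : Submodule ℝ (L2Fun d × L2Vec d)) (e : ℕ)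
    (hE : ∀ k, harmonicSpace d e k ≤ eigenspace V (lam d k))
    (htot : ∀ u : L2Fun d, (∀ k, ∀ v ∈ harmonicSpace d e k, inner ℝ u v = 0) → u = 0) :
    (∀ k, multiplicity V (lam d k) = Module.finrank ℝ (parityHarmonic (Fin.last d) e k)) ∧
      ∀ t, t ∉ Set.range (lam d) → multiplicity V t = 0 := by
  obtain ⟨h1, h2⟩ := eigenspace_eq_of_total V (lam d) (harmonicSpace d e) hE htot
  constructor
  · intro k
    rw [multiplicity, h1 (lam_strictMono hd).injective k, ← finrank_harmonicSpace,
      ← Module.finrank_eq_rank, Cardinal.toENat_nat]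
  · intro t ht
    rw [multiplicity, h2 t ht]
    simp

theorem multiplicity_neumann (hd : 2 ≤ d) :
    (∀ k, multiplicity (H1 d) (lam d k) =
      Module.finrank ℝ (parityHarmonic (Fin.last d) 0 k)) ∧
      ∀ t, t ∉ Set.range (lam d) → multiplicity (H1 d) t = 0 :=
  multiplicity_of_total hd _ 0 harmonicSpace_zero_le fun u h =>
    eq_zero_of_integral_mul_even_eq_zero u (integral_mul_parity_eq_zero h)

theorem multiplicity_dirichlet (hd : 2 ≤ d) :
    (∀ k, multiplicity (H10 d) (lam d k) =
      Module.finrank ℝ (parityHarmonic (Fin.last d) 1 k)) ∧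
      ∀ t, t ∉ Set.range (lam d) → multiplicity (H10 d) t = 0 :=
  multiplicity_of_total hd _ 1 harmonicSpace_one_le fun u h =>
    eq_zero_of_integral_mul_odd_eq_zero u (integral_mul_parity_eq_zero h)

end Total

/-! ### The Riesz means as finite sums -/

section RieszSum

variable {d : ℕ}

theorem rieszMean_eq_sum (hd : 2 ≤ d) (V : Submodule ℝ (L2Fun d × L2Vec d)) (m : ℕ → ℕ)
    (h1 : ∀ k, multiplicity V (lam d k) = m k)
    (h2 : ∀ t, t ∉ Set.range (lam d) → multiplicity V t = 0) (z : ℝ) (N : ℕ)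
    (hN : ∀ k, N ≤ k → z ≤ lam d k) :
    rieszMean V z = ∑ k ∈ Finset.range N, (m k : ENNReal) * ENNReal.ofReal (z - lam d k) := by
  have hs : Function.support (fun t : ℝ => (multiplicity V t : ENNReal) * ENNReal.ofReal (z - t)) ⊆
      Set.range (lam d) := by
    intro t ht
    by_contra hcon
    exact ht (by simp [h2 t hcon])
  rw [rieszMean, ← (lam_strictMono hd).injective.tsum_eq hs, tsum_eq_sum (s := Finset.range N)]
  · exact Finset.sum_congr rfl fun k _ => by rw [h1 k]; simp
  · intro k hk
    rw [Finset.mem_range, not_lt] at hk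
    rw [ENNReal.ofReal_of_nonpos (by linarith [hN k hk]), mul_zero]

theorem le_lam (hd : 2 ≤ d) (k : ℕ) : (k : ℝ) ≤ lam d k := by
  have h1 : (2 : ℝ) ≤ d := by exact_mod_cast hd
  have h2 : (0 : ℝ) ≤ k := Nat.cast_nonneg k
  rw [lam]
  nlinarith

theorem rieszMean_ne_top (hd : 2 ≤ d) (V : Submodule ℝ (L2Fun d × L2Vec d)) (m : ℕ → ℕ)
    (h1 : ∀ k, multiplicity V (lam d k) = m k)
    (h2 : ∀ t, t ∉ Set.range (lam d) → multiplicity V t = 0) (z : ℝ) : rieszMean V z ≠ ⊤ := by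
  rw [rieszMean_eq_sum hd V m h1 h2 z ⌈z⌉₊ fun k hk =>
    (Nat.ceil_le.mp hk).trans (le_lam hd k)]
  exact ENNReal.sum_ne_top.mpr fun k _ => ENNReal.mul_ne_top (by simp) ENNReal.ofReal_ne_top

/-- As `z` is the value at `w` of the increasing function `x ↦ x(x+d-1)`, which gives the
eigenvalues at integers, the terms with `k ≤ ⌊w⌋` are nonnegative and the others have zero positive
part. -/
theorem rieszMean_toReal (hd : 2 ≤ d) (V : Submodule ℝ (L2Fun d × L2Vec d)) (m : ℕ → ℕ)
    (h1 : ∀ k, multiplicity V (lam d k) = m k)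
    (h2 : ∀ t, t ∉ Set.range (lam d) → multiplicity V t = 0) {z w : ℝ} (hw : 0 ≤ w)
    (hz : w * (w + d - 1) = z) :
    (rieszMean V z).toReal = ∑ k ∈ Finset.range (⌊w⌋₊ + 1), (m k : ℝ) * (z - lam d k) := by
  have hd' : (2 : ℝ) ≤ d := by exact_mod_cast hd
  rw [rieszMean_eq_sum hd V m h1 h2 z (⌊w⌋₊ + 1), ENNReal.toReal_sum]
  · refine Finset.sum_congr rfl fun k hk => ?_
    have hk' : (k : ℝ) ≤ w :=
      (Nat.cast_le.mpr (Nat.lt_succ_iff.mp (Finset.mem_range.mp hk))).trans (Nat.floor_le hw)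
    have hk0 : (0 : ℝ) ≤ k := Nat.cast_nonneg k
    have : 0 ≤ z - lam d k := by
      rw [← hz, lam]
      nlinarith
    rw [ENNReal.toReal_mul, ENNReal.toReal_natCast, ENNReal.toReal_ofReal this]
  · exact fun k _ => ENNReal.mul_ne_top (by simp) ENNReal.ofReal_ne_top
  · intro k hk
    have hk' : w ≤ k := (Nat.lt_floor_add_one w).le.trans (by exact_mod_cast hk)
    rw [← hz, lam]
    nlinarith

end RieszSum

/-! ### Areas and semiclassical constants -/

section Area

open scoped Pointwise

/-- `toSphere` measures a set by the cone over it, which here is half of the unit ball. -/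
theorem Ioo_smul_hemi (d : ℕ) :
    Set.Ioo (0 : ℝ) 1 • ((fun x : Sph d => (x : Amb d)) '' hemi d) =
      upperHalf d ∩ Metric.ball 0 1 := by
  ext x
  simp only [Set.mem_smul, Set.mem_image, Set.mem_inter_iff, mem_ball_zero_iff]
  constructor
  · rintro ⟨t, ht, _, ⟨y, hy, rfl⟩, rfl⟩
    have hy' : 0 < (y : Amb d) (Fin.last d) := hy
    refine ⟨?_, ?_⟩
    · show 0 < (t • (y : Amb d)) (Fin.last d)
      rw [PiLp.smul_apply, smul_eq_mul]
      exact mul_pos ht.1 hy'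
    · rw [norm_smul, norm_coe_sph, mul_one, Real.norm_eq_abs, abs_of_pos ht.1]
      exact ht.2
  · rintro ⟨hx, hx1⟩
    have hx' : 0 < x (Fin.last d) := hx
    have hx0 : x ≠ 0 := by
      rintro rfl
      simp at hx'
    have hn : 0 < ‖x‖ := norm_pos_iff.mpr hx0
    have hw : (‖x‖⁻¹ • x) ∈ Metric.sphere (0 : Amb d) 1 := by
      rw [mem_sphere_zero_iff_norm, norm_smul, norm_inv, norm_norm, inv_mul_cancel₀ hn.ne']
    refine ⟨‖x‖, ⟨hn, hx1⟩, ‖x‖⁻¹ • x, ⟨⟨_, hw⟩, ?_, rfl⟩, ?_⟩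
    · show 0 < (‖x‖⁻¹ • x) (Fin.last d)
      rw [PiLp.smul_apply, smul_eq_mul]
      positivity
    · rw [smul_smul, mul_inv_cancel₀ hn.ne', one_smul]

theorem volume_equator_eq_zero (d : ℕ) : volume {x : Amb d | x (Fin.last d) = 0} = 0 := by
  let S : Submodule ℝ (Amb d) :=
    LinearMap.ker (EuclideanSpace.proj (Fin.last d) : Amb d →L[ℝ] ℝ).toLinearMap
  refine Measure.addHaar_submodule volume S fun h => ?_
  have h1 : (EuclideanSpace.single (Fin.last d) 1 : Amb d) ∈ S := by rw [h]; trivial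
  have h2 : (EuclideanSpace.single (Fin.last d) 1 : Amb d) (Fin.last d) = (0 : ℝ) := h1
  simp at h2

theorem volume_ball_eq_two_mul (d : ℕ) : volume (Metric.ball (0 : Amb d) 1) =
    2 * volume (upperHalf d ∩ Metric.ball (0 : Amb d) 1) := by
  have hU := (isOpen_upperHalf d).measurableSet
  have h1 := measure_inter_add_sdiff (μ := volume) (Metric.ball (0 : Amb d) 1) hU
  have h2 : volume (Metric.ball (0 : Amb d) 1 \ upperHalf d) =
      volume (upperHalf d ∩ Metric.ball (0 : Amb d) 1) := by
    rw [← Measure.measure_neg volume (upperHalf d ∩ Metric.ball (0 : Amb d) 1)]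
    refine le_antisymm ?_ (measure_mono ?_)
    · have hsub : Metric.ball (0 : Amb d) 1 \ upperHalf d ⊆
          -(upperHalf d ∩ Metric.ball (0 : Amb d) 1) ∪ {x : Amb d | x (Fin.last d) = 0} := by
        rintro x ⟨hx1, hx2⟩
        have hx2' : ¬ 0 < x (Fin.last d) := hx2
        rcases (not_lt.mp hx2').lt_or_eq with h | h
        · left
          refine ⟨?_, by simpa using hx1⟩
          show 0 < (-x) (Fin.last d)
          rw [PiLp.neg_apply]
          linarith
        · right; exact h
      refine (measure_mono hsub).trans ((measure_union_le _ _).trans ?_)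
      rw [volume_equator_eq_zero, add_zero]
    · rintro x ⟨hx1, hx2⟩
      have hx1' : 0 < (-x) (Fin.last d) := hx1
      rw [PiLp.neg_apply] at hx1'
      refine ⟨by simpa using hx2, fun hcon => ?_⟩
      have : 0 < x (Fin.last d) := hcon
      linarith
  rw [← h1, h2, Set.inter_comm, two_mul]

theorem volume_real_ball (d : ℕ) : (volume : Measure (EuclideanSpace ℝ (Fin (d + 1)))).real
    (Metric.ball 0 1) = √Real.pi ^ (d + 1) / Real.Gamma ((d + 1 : ℕ) / 2 + 1) := by
  rw [Measure.real, EuclideanSpace.volume_ball, Fintype.card_fin, ENNReal.ofReal_one, one_pow,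
    one_mul, ENNReal.toReal_ofReal]
  have : 0 < Real.Gamma ((d + 1 : ℕ) / 2 + 1) := Real.Gamma_pos_of_pos (by positivity)
  positivity

theorem hemiArea_eq (d : ℕ) :
    hemiArea d = √Real.pi ^ (d + 1) / Real.Gamma (((d : ℝ) + 1) / 2) := by
  have h := volume_ball_eq_two_mul d
  have h1 := congrArg ENNReal.toReal h
  rw [ENNReal.toReal_mul] at h1
  have h2 := volume_real_ball d
  rw [Measure.real, h1] at h2
  have h3 : hemiArea d = (d + 1) * (volume (upperHalf d ∩ Metric.ball (0 : Amb d) 1)).toReal := by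
    rw [hemiArea, surf, Measure.real, Measure.toSphere_apply' _ (isOpen_hemi d).measurableSet,
      ENNReal.toReal_mul]
    have := Ioo_smul_hemi d
    rw [this, finrank_euclideanSpace_fin, ENNReal.toReal_natCast]
    push_cast
    ring
  have h4 : Real.Gamma (((d + 1 : ℕ) : ℝ) / 2 + 1) =
      ((d : ℝ) + 1) / 2 * Real.Gamma (((d : ℝ) + 1) / 2) := by
    push_cast
    exact Real.Gamma_add_one (by positivity)
  have h5 : 0 < Real.Gamma (((d : ℝ) + 1) / 2) := Real.Gamma_pos_of_pos (by positivity)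
  rw [h4] at h2
  rw [h3]
  simp only [ENNReal.toReal_ofNat] at h2
  field_simp at h2 ⊢
  linarith

theorem equatorArea_eq (n : ℕ) :
    equatorArea (n + 1) = 2 * √Real.pi ^ (n + 1) / Real.Gamma (((n : ℝ) + 1) / 2) := by
  rw [equatorArea, Measure.toSphere_real_apply_univ, volume_real_ball, finrank_euclideanSpace_fin]
  have h4 : Real.Gamma (((n + 1 : ℕ) : ℝ) / 2 + 1) =
      ((n : ℝ) + 1) / 2 * Real.Gamma (((n : ℝ) + 1) / 2) := by
    push_cast
    exact Real.Gamma_add_one (by positivity)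
  have h5 : 0 < Real.Gamma (((n : ℝ) + 1) / 2) := Real.Gamma_pos_of_pos (by positivity)
  rw [h4]
  push_cast
  field_simp

theorem four_pi_rpow (m : ℕ) :
    (4 * Real.pi) ^ (-(m : ℝ) / 2) = ((2 * √Real.pi) ^ m)⁻¹ := by
  have h : (4 * Real.pi : ℝ) = (2 * √Real.pi) ^ (2 : ℝ) := by
    rw [Real.rpow_two, mul_pow, Real.sq_sqrt Real.pi_pos.le]
    norm_num
  rw [h, ← Real.rpow_mul (by positivity), ← Real.rpow_natCast, ← Real.rpow_neg (by positivity)]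
  congr 1
  ring

theorem Gamma_duplication (n : ℕ) : Real.Gamma (((n : ℝ) + 1) / 2) *
    Real.Gamma (((n : ℝ) + 2) / 2) = n.factorial * (2 ^ n)⁻¹ * √Real.pi := by
  have h := Real.Gamma_mul_Gamma_add_half (((n : ℝ) + 1) / 2)
  have e1 : ((n : ℝ) + 1) / 2 + 1 / 2 = (n + 2) / 2 := by ring
  have e2 : 2 * (((n : ℝ) + 1) / 2) = n + 1 := by ring
  rw [e1, e2, Real.Gamma_nat_eq_factorial] at h
  rw [h, show (1 : ℝ) - (n + 1) = -(n : ℝ) by ring, Real.rpow_neg (by norm_num), Real.rpow_natCast]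

theorem Lclass_eq (n : ℕ) : Lclass 1 ((n + 1 : ℕ) : ℝ) =
    ((2 * √Real.pi) ^ (n + 1))⁻¹ /
      ((((n : ℝ) + 3) / 2) * (((n : ℝ) + 1) / 2) * Real.Gamma (((n : ℝ) + 1) / 2)) := by
  have h2 : Real.Gamma (1 + 1) = 1 := by norm_num [Real.Gamma_two]
  rw [Lclass, four_pi_rpow, h2, mul_one]
  congr 1
  rw [show (1 : ℝ) + 1 + ((n + 1 : ℕ) : ℝ) / 2 = ((n : ℝ) + 1) / 2 + 1 + 1 by push_cast; ring,
    Real.Gamma_add_one (by positivity), Real.Gamma_add_one (by positivity)]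
  ring

theorem Lclass_pred_eq (n : ℕ) : Lclass 1 (((n + 1 : ℕ) : ℝ) - 1) =
    ((2 * √Real.pi) ^ n)⁻¹ / ((((n : ℝ) + 2) / 2) * Real.Gamma (((n : ℝ) + 2) / 2)) := by
  have h2 : Real.Gamma (1 + 1) = 1 := by norm_num [Real.Gamma_two]
  rw [show ((n + 1 : ℕ) : ℝ) - 1 = (n : ℝ) by push_cast; ring, Lclass, four_pi_rpow, h2, mul_one]
  congr 1
  rw [show (1 : ℝ) + 1 + (n : ℝ) / 2 = ((n : ℝ) + 2) / 2 + 1 by ring,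
    Real.Gamma_add_one (by positivity)]

/-- Matches the Weyl constant with the leading coefficient of the explicit sums. The two Gamma
factors occur as a product, which the duplication formula evaluates. -/
theorem Lclass_mul_hemiArea (n : ℕ) :
    Lclass 1 ((n + 1 : ℕ) : ℝ) * hemiArea (n + 1) = 2 / ((n + 3) * (n + 1).factorial) := by
  have hA : 0 < Real.Gamma (((n : ℝ) + 1) / 2) := Real.Gamma_pos_of_pos (by positivity)
  have hB : 0 < Real.Gamma (((n : ℝ) + 2) / 2) := Real.Gamma_pos_of_pos (by positivity)
  have hd := Gamma_duplication n
  have hpi : 0 < √Real.pi := Real.sqrt_pos.mpr Real.pi_pos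
  rw [Lclass_eq, hemiArea_eq, Nat.factorial_succ]
  rw [show ((n + 1 : ℕ) : ℝ) + 1 = n + 2 by push_cast; ring]
  push_cast
  have h2 : (n.factorial : ℝ) ≠ 0 := by positivity
  generalize Real.Gamma (((n : ℝ) + 1) / 2) = A at *
  generalize Real.Gamma (((n : ℝ) + 2) / 2) = B at *
  generalize √Real.pi = q at *
  have hd' : A * B * 2 ^ n = n.factorial * q := by
    rw [hd]; field_simp
  have e : ((2 * q) ^ (n + 1))⁻¹ / (((n : ℝ) + 3) / 2 * ((n + 1) / 2) * A) * (q ^ (n + 1 + 1) / B) =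
      2 * q / ((n + 3) * (n + 1) * (A * B * 2 ^ n)) := by
    rw [mul_pow]
    field_simp
    ring
  rw [e, hd']
  field_simp

theorem boundary_coefficient (n : ℕ) :
    1 / 4 * (Lclass 1 (((n + 1 : ℕ) : ℝ) - 1) / Lclass 1 ((n + 1 : ℕ) : ℝ)) *
      (equatorArea (n + 1) / hemiArea (n + 1)) =
      ((n + 1 : ℕ) : ℝ) * ((n + 1 : ℕ) + 2) / (2 * ((n + 1 : ℕ) + 1)) := by
  have hA : 0 < Real.Gamma (((n : ℝ) + 1) / 2) := Real.Gamma_pos_of_pos (by positivity)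
  have hB : 0 < Real.Gamma (((n : ℝ) + 2) / 2) := Real.Gamma_pos_of_pos (by positivity)
  have hpi : 0 < √Real.pi := Real.sqrt_pos.mpr Real.pi_pos
  rw [Lclass_eq, Lclass_pred_eq, hemiArea_eq, equatorArea_eq]
  rw [show ((n + 1 : ℕ) : ℝ) + 1 = n + 2 by push_cast; ring]
  push_cast
  generalize Real.Gamma (((n : ℝ) + 1) / 2) = A at *
  generalize Real.Gamma (((n : ℝ) + 2) / 2) = B at *
  generalize √Real.pi = q at *
  field_simp
  ring

end Area

/-! ### The two asymptotic expansions -/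

section Final

/-- The substitution `z = r²` turns the real powers of `z` into integer powers of `r`. -/
theorem isBigO_of_sqrt_bound (n : ℕ) (w : ℝ → ℝ)
    (hw : ∀ z : ℝ, 0 ≤ z → 0 ≤ w z ∧ w z * (w z + ((n + 1 : ℕ) : ℝ) - 1) = z) (R : ℝ → ℝ)
    (S : ℝ → ℝ → ℝ) (c K : ℝ) (hR : ∀ z, 0 ≤ z → R z = S z (w z))
    (hK : ∀ r w : ℝ, 1 ≤ r → 0 ≤ w → w * (w + n) = r ^ 2 →
      |S (r ^ 2) w / (2 / ((n + 3) * (n + 1).factorial) * r ^ (n + 3)) -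
        (1 + c * r⁻¹ + ((n : ℝ) + 1) * (n + 3) / 2 * (1 / 4 - psi w ^ 2 + ((n : ℝ) - 1) / 6) *
          r⁻¹ ^ 2)| ≤ K * r⁻¹ ^ 3) :
    (fun z : ℝ => R z / (Lclass 1 ((n + 1 : ℕ) : ℝ) * hemiArea (n + 1) *
        z ^ (((n + 1 : ℕ) : ℝ) / 2 + 1)) -
      (1 + c * z ^ (-(1 / 2) : ℝ) + ((n + 1 : ℕ) : ℝ) * ((n + 1 : ℕ) + 2) / 2 *
        (1 / 4 - psi (w z) ^ 2 + (((n + 1 : ℕ) : ℝ) - 2) / 6) * z⁻¹))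
      =O[atTop] fun z : ℝ => z ^ (-(3 / 2) : ℝ) := by
  refine IsBigO.of_bound K ?_
  filter_upwards [eventually_ge_atTop 1] with z hz
  have hz0 : 0 ≤ z := by linarith
  obtain ⟨r, hr, rfl⟩ : ∃ r : ℝ, 1 ≤ r ∧ z = r ^ 2 :=
    ⟨√z, Real.one_le_sqrt.mpr hz, (Real.sq_sqrt hz0).symm⟩
  have hr0 : 0 < r := by linarith
  obtain ⟨hw1, hw2⟩ := hw (r ^ 2) hz0
  have h := hK r (w (r ^ 2)) hr hw1 (by push_cast at hw2; linarith)
  have hpow : ∀ a : ℝ, (r ^ 2) ^ a = r ^ (2 * a) := fun a => by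
    rw [← Real.rpow_natCast, ← Real.rpow_mul hr0.le]; norm_num
  have e1 : (r ^ 2) ^ (((n + 1 : ℕ) : ℝ) / 2 + 1) = r ^ (n + 3) := by
    rw [hpow, ← Real.rpow_natCast]; congr 1; push_cast; ring
  have e2 : (r ^ 2) ^ (-(1 / 2) : ℝ) = r⁻¹ := by
    rw [hpow, ← Real.rpow_neg_one]; congr 1; norm_num
  have e3 : (r ^ 2) ^ (-(3 / 2) : ℝ) = r⁻¹ ^ 3 := by
    rw [hpow, inv_pow, ← Real.rpow_natCast, ← Real.rpow_neg hr0.le]; congr 1; norm_num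
  rw [e1, e2, e3, Lclass_mul_hemiArea, hR _ hz0, Real.norm_eq_abs, Real.norm_eq_abs,
    abs_of_pos (by positivity : 0 < r⁻¹ ^ 3), ← inv_pow]
  refine le_trans (le_of_eq ?_) h
  congr 3
  push_cast
  ring

theorem rieszN_isBigO (n : ℕ) (hn : 1 ≤ n) (w : ℝ → ℝ)
    (hw : ∀ z : ℝ, 0 ≤ z → 0 ≤ w z ∧ w z * (w z + ((n + 1 : ℕ) : ℝ) - 1) = z) :
    (fun z : ℝ => (rieszN (n + 1) z).toReal / (Lclass 1 ((n + 1 : ℕ) : ℝ) * hemiArea (n + 1) *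
        z ^ (((n + 1 : ℕ) : ℝ) / 2 + 1)) -
      (1 + ((n + 1 : ℕ) : ℝ) * ((n + 1 : ℕ) + 2) / (2 * ((n + 1 : ℕ) + 1)) * z ^ (-(1 / 2) : ℝ) +
        ((n + 1 : ℕ) : ℝ) * ((n + 1 : ℕ) + 2) / 2 *
        (1 / 4 - psi (w z) ^ 2 + (((n + 1 : ℕ) : ℝ) - 2) / 6) * z⁻¹))
      =O[atTop] fun z : ℝ => z ^ (-(3 / 2) : ℝ) := by
  obtain ⟨K, hK⟩ := even_sum_asymptotics n
  have hd : 2 ≤ n + 1 := by omega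
  refine isBigO_of_sqrt_bound n w hw _ (fun z w => ∑ k ∈ Finset.range (⌊w⌋₊ + 1),
    ((k + n).choose n : ℝ) * (z - k * (k + n))) _ K (fun z hz => ?_) (fun r w hr hw0 hz => ?_)
  · obtain ⟨h1, h2⟩ := hw z hz
    refine (rieszMean_toReal hd (H1 (n + 1)) _ (multiplicity_neumann hd).1
      (multiplicity_neumann hd).2 h1 h2).trans ?_
    refine Finset.sum_congr rfl fun k _ => ?_
    rw [finrank_evenHarmonic n k, lam]
    push_cast
    ring
  · have h := hK r w hr hw0 hz
    refine le_trans (le_of_eq ?_) h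
    congr 5
    push_cast
    ring

theorem rieszD_isBigO (n : ℕ) (hn : 1 ≤ n) (w : ℝ → ℝ)
    (hw : ∀ z : ℝ, 0 ≤ z → 0 ≤ w z ∧ w z * (w z + ((n + 1 : ℕ) : ℝ) - 1) = z) :
    (fun z : ℝ => (rieszD (n + 1) z).toReal / (Lclass 1 ((n + 1 : ℕ) : ℝ) * hemiArea (n + 1) *
        z ^ (((n + 1 : ℕ) : ℝ) / 2 + 1)) -
      (1 - ((n + 1 : ℕ) : ℝ) * ((n + 1 : ℕ) + 2) / (2 * ((n + 1 : ℕ) + 1)) * z ^ (-(1 / 2) : ℝ) +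
        ((n + 1 : ℕ) : ℝ) * ((n + 1 : ℕ) + 2) / 2 *
        (1 / 4 - psi (w z) ^ 2 + (((n + 1 : ℕ) : ℝ) - 2) / 6) * z⁻¹))
      =O[atTop] fun z : ℝ => z ^ (-(3 / 2) : ℝ) := by
  obtain ⟨K, hK⟩ := odd_sum_asymptotics n
  have hd : 2 ≤ n + 1 := by omega
  have hmain := isBigO_of_sqrt_bound n w hw (fun z => (rieszD (n + 1) z).toReal)
    (fun z w => ∑ k ∈ Finset.range ⌊w⌋₊,
      ((k + n).choose n : ℝ) * (z - (k + 1) * (k + 1 + n)))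
    (-(((n + 1 : ℕ) : ℝ) * ((n + 1 : ℕ) + 2) / (2 * ((n + 1 : ℕ) + 1)))) K (fun z hz => ?_)
    (fun r w hr hw0 hz => ?_)
  · simpa only [neg_mul, ← sub_eq_add_neg] using hmain
  · obtain ⟨h1, h2⟩ := hw z hz
    refine (rieszMean_toReal hd (H10 (n + 1)) _ (multiplicity_dirichlet hd).1
      (multiplicity_dirichlet hd).2 h1 h2).trans ?_
    -- The term of degree zero is split off and vanishes; the remaining degrees `k + 1` run over `k
    -- < ⌊w⌋`, as in `sum_odd_closed`.
    rw [Finset.sum_range_succ', finrank_oddHarmonic_zero, Nat.cast_zero, zero_mul, add_zero]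
    refine Finset.sum_congr rfl fun k _ => ?_
    rw [finrank_oddHarmonic_succ n k, lam]
    push_cast
    ring
  · have h := hK r w hr hw0 hz
    refine le_trans (le_of_eq ?_) h
    congr 3
    push_cast
    ring

end Final

end HemisphereRiesz

end

/-! ### Finiteness and both forms of the expansions. -/

theorem mainTheorem5 (d : ℕ) (hd : 2 ≤ d) (w : ℝ → ℝ)
    (hw : ∀ z : ℝ, 0 ≤ z → 0 ≤ w z ∧ w z * (w z + (d : ℝ) - 1) = z) :
    (∀ z : ℝ, HemisphereRiesz.rieszD d z ≠ ⊤ ∧ HemisphereRiesz.rieszN d z ≠ ⊤) ∧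
    ((fun z : ℝ =>
        (HemisphereRiesz.rieszD d z).toReal /
            (HemisphereRiesz.Lclass 1 d * HemisphereRiesz.hemiArea d * z ^ ((d : ℝ) / 2 + 1)) -
          (1 - 1 / 4 * (HemisphereRiesz.Lclass 1 ((d : ℝ) - 1) / HemisphereRiesz.Lclass 1 d) *
                (HemisphereRiesz.equatorArea d / HemisphereRiesz.hemiArea d) *
                z ^ (-(1 / 2) : ℝ) +
            (d : ℝ) * (d + 2) / 2 *
              (1 / 4 - HemisphereRiesz.psi (w z) ^ 2 + ((d : ℝ) - 2) / 6) * z⁻¹))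
      =O[atTop] fun z : ℝ => z ^ (-(3 / 2) : ℝ)) ∧
    ((fun z : ℝ =>
        (HemisphereRiesz.rieszD d z).toReal /
            (HemisphereRiesz.Lclass 1 d * HemisphereRiesz.hemiArea d * z ^ ((d : ℝ) / 2 + 1)) -
          (1 - (d : ℝ) * (d + 2) / (2 * (d + 1)) * z ^ (-(1 / 2) : ℝ) +
            (d : ℝ) * (d + 2) / 2 *
              (1 / 4 - HemisphereRiesz.psi (w z) ^ 2 + ((d : ℝ) - 2) / 6) * z⁻¹))
      =O[atTop] fun z : ℝ => z ^ (-(3 / 2) : ℝ)) ∧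
    ((fun z : ℝ =>
        (HemisphereRiesz.rieszN d z).toReal /
            (HemisphereRiesz.Lclass 1 d * HemisphereRiesz.hemiArea d * z ^ ((d : ℝ) / 2 + 1)) -
          (1 + 1 / 4 * (HemisphereRiesz.Lclass 1 ((d : ℝ) - 1) / HemisphereRiesz.Lclass 1 d) *
                (HemisphereRiesz.equatorArea d / HemisphereRiesz.hemiArea d) *
                z ^ (-(1 / 2) : ℝ) +
            (d : ℝ) * (d + 2) / 2 *
              (1 / 4 - HemisphereRiesz.psi (w z) ^ 2 + ((d : ℝ) - 2) / 6) * z⁻¹))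
      =O[atTop] fun z : ℝ => z ^ (-(3 / 2) : ℝ)) ∧
    ((fun z : ℝ =>
        (HemisphereRiesz.rieszN d z).toReal /
            (HemisphereRiesz.Lclass 1 d * HemisphereRiesz.hemiArea d * z ^ ((d : ℝ) / 2 + 1)) -
          (1 + (d : ℝ) * (d + 2) / (2 * (d + 1)) * z ^ (-(1 / 2) : ℝ) +
            (d : ℝ) * (d + 2) / 2 *
              (1 / 4 - HemisphereRiesz.psi (w z) ^ 2 + ((d : ℝ) - 2) / 6) * z⁻¹))
      =O[atTop] fun z : ℝ => z ^ (-(3 / 2) : ℝ)) := by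
  obtain ⟨n, rfl⟩ : ∃ n, d = n + 1 := ⟨d - 1, by omega⟩
  have hn : 1 ≤ n := by omega
  have hD := HemisphereRiesz.rieszD_isBigO n hn w hw
  have hN := HemisphereRiesz.rieszN_isBigO n hn w hw
  refine ⟨fun z => ⟨?_, ?_⟩, ?_, hD, ?_, hN⟩
  · exact HemisphereRiesz.rieszMean_ne_top hd _ _ (HemisphereRiesz.multiplicity_dirichlet hd).1
      (HemisphereRiesz.multiplicity_dirichlet hd).2 z
  · exact HemisphereRiesz.rieszMean_ne_top hd _ _ (HemisphereRiesz.multiplicity_neumann hd).1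
      (HemisphereRiesz.multiplicity_neumann hd).2 z
  -- The geometric form differs from the explicit one only in how the boundary coefficient is
  -- written.
  · rw [HemisphereRiesz.boundary_coefficient]
    exact hD
  · rw [HemisphereRiesz.boundary_coefficient]
    exact hN
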